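/- **Setting.** Let $G$ be a group. Monoids and semirings are commutative with units. A *Mackey system* $(\mathcal C,\mathcal O)$ on $G$ is a set $\mathcal C$ of subgroups closed under conjugation and pairwise intersection, with sets $\mathcal O(H)\subseteq\{U\in\mathcal C: U\le H\}$ for $H\in\mathcal C$, such that for $U\in\mathcal O(H)$, $V\in\mathcal C$, $V\le H$, $g\in G$: $[H:U]<\infty$, $\mathcal O(U)\subseteq\mathcal O(H)$, $\mathcal O(gHg^{-1})=g\mathcal O(H)g^{-1}$ and $U\cap V\in\mathcal O(V)$. Let $G\mathrm{Set}_{\mathcal C}$ be the category of $G$-sets all of whose stabilizers lie in $\mathcal C$, with equivariant maps, and let $G\mathrm{Set}_{\mathcal C,\mathcal O}$ consist of those maps $f\colon X\to Y$ in it that have finite fibers and satisfy $G_x\in\mathcal O(G_{f(x)})$ for all $x\in X$. A *semi-Mackey functor* $M=(M^*,M_*)$ on $(\mathcal C,\mathcal O)$ consists of monoids $M(X)$ for $X\in G\mathrm{Set}_{\mathcal C}$, monoid homomorphisms $M^*(f)$, contravariantly functorial on $G\mathrm{Set}_{\mathcal C}$, and monoid homomorphisms $M_*(f)$, covariantly functorial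 on $G\mathrm{Set}_{\mathcal C,\mathcal O}$, such that: (Mackey condition) for every pull-back square in $G\mathrm{Set}_{\mathcal C}$ with $f\colon Y'\to Y$, $g\colon X\to Y$, $g'\colon X'\to Y'$, $f'\colon X'\to X$ and $g$ in $G\mathrm{Set}_{\mathcal C,\mathcal O}$, one has $M^*(f)M_*(g)=M_*(g')M^*(f')$; (additivity) for every decomposition $X=\coprod_{\lambda\in\Lambda}X_\lambda$ (with $\Lambda$ any set) the map $M(X)\to\prod_\lambda M(X_\lambda)$ of restrictions is bijective. A *Tambara system* on $G$ is given by a set $\widetilde{\mathcal C}$ of subsets of $G$, closed under left and right translation, pairwise intersection and pairwise union, and a Mackey system $(\mathcal C,\mathcal O_\bullet)$ with $\mathcal C=\{H\in\widetilde{\mathcal C}: H\le G\}$ and $H\in\mathcal O_\bullet(H)$ for all $H\in\mathcal C$. Put $\mathcal O_{\mathcal C}(H)=\{U\in\mathcal C: U\le H,\ [H:U]<\infty\}$; then $(\mathcal C,\mathcal O_{\mathcal C})$ is a Mackey system, and $G\mathrm{Set}_{\mathcal C,\mathcal O_{\mathcal C}}$ consists of the maps with finite fibers. For $\eta\colon X\to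 Y$ in $G\mathrm{Set}_{\mathcal C,\mathcal O_\bullet}$ and $p\colon A\to X$ in $G\mathrm{Set}_{\mathcal C,\mathcal O_{\mathcal C}}$, let $\Pi_\eta(A)$ be the $G$-set of pairs $(y,\sigma)$ with $y\in Y$ and $\sigma\colon\eta^{-1}(y)\to A$ a map with $p\sigma=\mathrm{id}$, let $\pi(y,\sigma)=y$, and let $\rho\colon X\times_Y\Pi_\eta(A)\to\Pi_\eta(A)$ be the projection and $\lambda(x,(y,\sigma))=\sigma(x)$. An *exponential diagram* on $\eta$ is a diagram $X\xleftarrow{\xi}Z\xleftarrow{\zeta}X'\xrightarrow{\eta'}Y'\xrightarrow{\upsilon}Y$ isomorphic over $\eta$ to $X\xleftarrow{p}A\xleftarrow{\lambda}X\times_Y\Pi_\eta(A)\xrightarrow{\rho}\Pi_\eta(A)\xrightarrow{\pi}Y$ for some such $p$. A *semi-Tambara functor* $S=(S^*,S_+,S_\bullet)$ consists of semirings $S(X)$ with semiring homomorphisms $S^*(f)$ for $f$ in $G\mathrm{Set}_{\mathcal C}$, additive homomorphisms $S_+(f)$ for $f$ in $G\mathrm{Set}_{\mathcal C,\mathcal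 O_{\mathcal C}}$ and multiplicative homomorphisms $S_\bullet(f)$ for $f$ in $G\mathrm{Set}_{\mathcal C,\mathcal O_\bullet}$, such that $(S^*,S_+)$ is a semi-Mackey functor on $(\mathcal C,\mathcal O_{\mathcal C})$ for the additive monoids, $(S^*,S_\bullet)$ is a semi-Mackey functor on $(\mathcal C,\mathcal O_\bullet)$ for the multiplicative monoids, and $S_+(\upsilon)S_\bullet(\eta')S^*(\zeta)=S_\bullet(\eta)S_+(\xi)$ for every exponential diagram as above. **Proposition.** Let $(\mathcal C,\mathcal O_{\mathcal C},\mathcal O_\bullet)$ be a Tambara system on $G$ and $M$ a semi-Mackey functor on $(\mathcal C,\mathcal O_\bullet)$. For $X\in G\mathrm{Set}_{\mathcal C}$ let $\mathcal S_M(X)$ be the collection of isomorphism classes of pairs $(A\xrightarrow{p}X,m_A)$, where $p$ is a map in $G\mathrm{Set}_{\mathcal C}$ with finite fibers and $m_A\in M(A)$; a morphism $(A_1\xrightarrow{p_1}X,m_{A_1})\to(A_2\xrightarrow{p_2}X,m_{A_2})$ is a map $f\colon A_1\to A_2$ with $p_2f=p_1$ and $M^*(f)(m_{A_2})=m_{A_1}$.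 Then $\mathcal S_M(X)$ is a semiring with $$[A_1,m_{A_1}]+[A_2,m_{A_2}]=[A_1\amalg A_2\xrightarrow{p_1\cup p_2}X,\ m_{A_1}\amalg m_{A_2}],$$ $$[A_1,m_{A_1}]\cdot[A_2,m_{A_2}]=[A_1\times_XA_2\to X,\ M^*(\varpi_1)(m_{A_1})\cdot M^*(\varpi_2)(m_{A_2})],$$ where $m_{A_1}\amalg m_{A_2}\in M(A_1\amalg A_2)$ is the element restricting to $m_{A_1}$ and $m_{A_2}$ and $\varpi_1,\varpi_2$ are the projections; and the semirings $\mathcal S_M(X)$ form a semi-Tambara functor whose structure maps are given by: 1. for $\zeta\colon Y\to X$ in $G\mathrm{Set}_{\mathcal C}$, $\zeta^*[A\xrightarrow{p}X,m_A]=[A'\xrightarrow{p'}Y,\ M^*(\zeta')(m_A)]$ for any pull-back square with $p'\colon A'\to Y$, $\zeta'\colon A'\to A$ of $p$ along $\zeta$; 2. for $\xi\colon X\to Y$ with finite fibers, $\xi_+[A\xrightarrow{p}X,m_A]=[A\xrightarrow{\xi p}Y,\ m_A]$; 3. for $\eta\colon X\to Y$ in $G\mathrm{Set}_{\mathcal C,\mathcal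 O_\bullet}$, $\eta_\bullet[A\xrightarrow{p}X,m_A]=[Y'\xrightarrow{\upsilon}Y,\ M_*(\rho)M^*(\lambda)(m_A)]$ for any exponential diagram $X\xleftarrow{p}A\xleftarrow{\lambda}X'\xrightarrow{\rho}Y'\xrightarrow{\upsilon}Y$ on $\eta$. In particular these operations are well defined, and the functoriality, additivity, Mackey and exponential conditions all hold. -/

import Mathlib

open CategoryTheory CategoryTheory.Limits
open scoped Pointwise

universe u w

namespace Tambarization

variable {G : Type u} [Group G]

/-! ### Mackey systems -/

/-- `(C, O)` is a Mackey system on `G`.  The family `O` is only constrained (and only used) at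
the members of `C`. -/
structure IsMackeySystem (C : Set (Subgroup G)) (O : Subgroup G → Set (Subgroup G)) : Prop where
  conj_mem : ∀ H ∈ C, ∀ g : G, MulAut.conj g • H ∈ C
  inf_mem : ∀ H ∈ C, ∀ K ∈ C, H ⊓ K ∈ C
  O_mem : ∀ H ∈ C, ∀ U ∈ O H, U ∈ C
  O_le : ∀ H ∈ C, ∀ U ∈ O H, U ≤ H
  finite_index : ∀ H ∈ C, ∀ U ∈ O H, U.relIndex H ≠ 0
  O_subset : ∀ H ∈ C, ∀ U ∈ O H, O U ⊆ O H
  O_conj : ∀ H ∈ C, ∀ g : G, O (MulAut.conj g • H) = (fun U => MulAut.conj g • U) '' O H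
  O_inf : ∀ H ∈ C, ∀ U ∈ O H, ∀ V ∈ C, V ≤ H → U ⊓ V ∈ O V

/-- The family `O_C(H)` of all members of `C` that are finite index subgroups of `H`. -/
def finO (C : Set (Subgroup G)) (H : Subgroup G) : Set (Subgroup G) :=
  {U | U ∈ C ∧ U ≤ H ∧ U.relIndex H ≠ 0}

theorem isMackeySystem_finO {C : Set (Subgroup G)}
    (hconj : ∀ H ∈ C, ∀ g : G, MulAut.conj g • H ∈ C)
    (hinf : ∀ H ∈ C, ∀ K ∈ C, H ⊓ K ∈ C) : IsMackeySystem C (finO C) where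
  conj_mem := hconj
  inf_mem := hinf
  O_mem _ _ _ hU := hU.1
  O_le _ _ _ hU := hU.2.1
  finite_index _ _ _ hU := hU.2.2
  O_subset H _ U hU V hV :=
    ⟨hV.1, hV.2.1.trans hU.2.1, by
      rw [← Subgroup.relIndex_mul_relIndex V U H hV.2.1 hU.2.1]
      exact mul_ne_zero hV.2.2 hU.2.2⟩
  O_conj H hH g := by
    have key : ∀ (H : Subgroup G), H ∈ C → ∀ (g : G) (U : Subgroup G), U ∈ finO C H →
        MulAut.conj g • U ∈ finO C (MulAut.conj g • H) := by
      intro H hH g U hU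
      refine ⟨hconj U hU.1 g, Subgroup.pointwise_smul_le_pointwise_smul_iff.2 hU.2.1, ?_⟩
      rw [Subgroup.relIndex_pointwise_smul]
      exact hU.2.2
    ext U
    constructor
    · intro hU
      refine ⟨MulAut.conj g⁻¹ • U, ?_, ?_⟩
      · have := key _ (hconj H hH g) g⁻¹ U hU
        simpa [smul_smul, ← map_mul] using this
      · simp [smul_smul]
    · rintro ⟨V, hV, rfl⟩
      exact key H hH g V hV
  O_inf H _ U hU V hV hVH := by
    refine ⟨hinf U hU.1 V hV, inf_le_right, ?_⟩
    rw [Subgroup.inf_relIndex_right]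
    exact fun h0 => hU.2.2 (Subgroup.relIndex_eq_zero_of_le_right hVH h0)

/-! ### The category of `G`-sets with stabilizers in `C` -/

/-- `G`-sets all of whose stabilizers lie in `C`. -/
structure GSetIn (C : Set (Subgroup G)) : Type (u + 1) where
  carrier : Type u
  [action : MulAction G carrier]
  stab_mem : ∀ x : carrier, MulAction.stabilizer G x ∈ C

namespace GSetIn

instance {C : Set (Subgroup G)} : CoeSort (GSetIn C) (Type u) := ⟨carrier⟩

attribute [instance] GSetIn.action

instance {C : Set (Subgroup G)} : Category.{u} (GSetIn C) where
  Hom X Y := X →[G] Y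
  id X := MulActionHom.id G
  comp f g := MulActionHom.comp g f

instance {C : Set (Subgroup G)} :
    ConcreteCategory (GSetIn C) (fun X Y : GSetIn C => X →[G] Y) where
  hom f := f
  ofHom f := f

variable {C : Set (Subgroup G)}

theorem map_smul {X Y : GSetIn C} (f : X ⟶ Y) (g : G) (x : X) : f (g • x) = g • f x :=
  _root_.map_smul (show X →[G] Y from f) g x

theorem stab_le {X Y : GSetIn C} (f : X ⟶ Y) (x : X) :
    MulAction.stabilizer G x ≤ MulAction.stabilizer G (f x) := by
  intro g hg
  rw [MulAction.mem_stabilizer_iff] at hg ⊢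
  rw [← map_smul, hg]

end GSetIn

section General

variable {C : Set (Subgroup G)} {O : Subgroup G → Set (Subgroup G)}

/-- The morphisms of the subcategory attached to `(C, O)`. -/
def IsOHom (O : Subgroup G → Set (Subgroup G)) {X Y : GSetIn C} (f : X ⟶ Y) : Prop :=
  (∀ y : Y, {x : X | f x = y}.Finite) ∧
    ∀ x : X, MulAction.stabilizer G x ∈ O (MulAction.stabilizer G (f x))

theorem IsOHom.comp (h : IsMackeySystem C O) {X Y Z : GSetIn C} {f : X ⟶ Y} {g : Y ⟶ Z}
    (hf : IsOHom O f) (hg : IsOHom O g) : IsOHom O (f ≫ g) := by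
  refine ⟨fun z => ?_, fun x => ?_⟩
  · refine ((hg.1 z).biUnion fun y _ => hf.1 y).subset fun x hx => ?_
    simp only [Set.mem_iUnion]
    exact ⟨f x, hx, rfl⟩
  · exact h.O_subset _ (Z.stab_mem _) _ (hg.2 (f x)) (hf.2 x)

theorem GSetIn.iso_stab {X Y : GSetIn C} (e : X ≅ Y) (x : X) :
    MulAction.stabilizer G (e.hom x) = MulAction.stabilizer G x := by
  refine le_antisymm ?_ (GSetIn.stab_le e.hom x)
  have h := GSetIn.stab_le e.inv (e.hom x)
  have hx : e.inv (e.hom x) = x := by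
    have := congrArg (fun k : X ⟶ X => k x) e.hom_inv_id
    exact this
  rwa [hx] at h

theorem GSetIn.iso_inj {X Y : GSetIn C} (e : X ≅ Y) : Function.Injective (fun x : X => e.hom x) := by
  intro x x' h
  have key : ∀ x : X, e.inv (e.hom x) = x := fun x =>
    congrArg (fun k : X ⟶ X => k x) e.hom_inv_id
  rw [← key x, ← key x']
  exact congrArg (fun y : Y => e.inv y) h

theorem IsOHom.iso_comp {X X' Y : GSetIn C} {f : X ⟶ Y} (e : X' ≅ X) (hf : IsOHom O f) :
    IsOHom O (e.hom ≫ f) := by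
  refine ⟨fun y => ?_, fun x => ?_⟩
  · exact (hf.1 y).preimage (f := fun x : X' => e.hom x) (GSetIn.iso_inj e).injOn
  · rw [← GSetIn.iso_stab e x]
    exact hf.2 (e.hom x)

theorem IsOHom.comp_iso {X Y Y' : GSetIn C} {f : X ⟶ Y} (e : Y ≅ Y') (hf : IsOHom O f) :
    IsOHom O (f ≫ e.hom) := by
  refine ⟨fun y => ?_, fun x => ?_⟩
  · refine (hf.1 (e.inv y)).subset fun x hx => ?_
    have hx' : e.hom (f x) = y := hx
    have : e.inv (e.hom (f x)) = f x := congrArg (fun k : Y ⟶ Y => k (f x)) e.hom_inv_id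
    rw [hx'] at this
    exact this.symm
  · have h := hf.2 x
    rw [← GSetIn.iso_stab e (f x)] at h
    exact h

/-- For `O = O_C`, the morphisms are exactly the maps with finite fibers. -/
theorem isOHom_finO {X Y : GSetIn C} (f : X ⟶ Y) (hf : ∀ y : Y, {x : X | f x = y}.Finite) :
    IsOHom (finO C) f := by
  refine ⟨hf, fun x => ⟨X.stab_mem x, GSetIn.stab_le f x, ?_⟩⟩
  have h1 : (MulAction.stabilizer G x).subgroupOf (MulAction.stabilizer G (f x)) =
      MulAction.stabilizer (MulAction.stabilizer G (f x)) x := by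
    ext g
    rfl
  rw [Subgroup.relIndex, h1, MulAction.index_stabilizer]
  have h2 : (MulAction.orbit (MulAction.stabilizer G (f x)) x).Finite := by
    refine (hf (f x)).subset ?_
    rintro _ ⟨g, rfl⟩
    exact (GSetIn.map_smul f (g : G) x).trans g.2
  exact (Set.ncard_pos h2).2 (MulAction.nonempty_orbit x) |>.ne'

/-! ### Fibered products and coproducts -/

/-- The fibered product `{(x, y) | f x = g y}`. -/
def fiberProd (h : IsMackeySystem C O) {X Y Z : GSetIn C} (f : X ⟶ Z) (g : Y ⟶ Z) :
    GSetIn C where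
  carrier := {q : X × Y // f q.1 = g q.2}
  action :=
    { smul := fun a q => ⟨(a • q.1.1, a • q.1.2), by
        simp only [GSetIn.map_smul, q.2]⟩
      one_smul := fun q => Subtype.ext (Prod.ext (one_smul G _) (one_smul G _))
      mul_smul := fun a b q => Subtype.ext (Prod.ext (mul_smul a b _) (mul_smul a b _)) }
  stab_mem q := by
    convert h.inf_mem _ (X.stab_mem q.1.1) _ (Y.stab_mem q.1.2) using 1
    ext a
    exact Subtype.ext_iff.trans Prod.ext_iff

namespace fiberProd

variable (h : IsMackeySystem C O) {X Y Z : GSetIn C} (f : X ⟶ Z) (g : Y ⟶ Z)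

/-- First projection. -/
def fst : fiberProd h f g ⟶ X where
  toFun q := q.1.1
  map_smul' _ _ := rfl

/-- Second projection. -/
def snd : fiberProd h f g ⟶ Y where
  toFun q := q.1.2
  map_smul' _ _ := rfl

theorem isPullback : IsPullback (fst h f g) (snd h f g) f g where
  w := MulActionHom.ext fun q => q.2
  isLimit' := ⟨PullbackCone.IsLimit.mk _
    (fun s =>
      { toFun := fun x => ⟨(s.fst x, s.snd x), congrArg (fun k : s.pt ⟶ Z => k x) s.condition⟩
        map_smul' := fun a x => Subtype.ext
          (Prod.ext (GSetIn.map_smul s.fst a x) (GSetIn.map_smul s.snd a x)) })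
    (fun _ => rfl) (fun _ => rfl)
    (fun s _ h1 h2 => MulActionHom.ext fun x => Subtype.ext (Prod.ext
      (congrArg (fun k : s.pt ⟶ X => k x) h1) (congrArg (fun k : s.pt ⟶ Y => k x) h2)))⟩

theorem isOHom_fst (hg : IsOHom O g) : IsOHom O (fst h f g) := by
  refine ⟨fun x => ?_, fun q => ?_⟩
  · refine Set.Finite.of_finite_image (f := fun q : fiberProd h f g => q.1.2) ?_ ?_
    · refine (hg.1 (f x)).subset ?_
      rintro _ ⟨q, hq, rfl⟩
      have hq' : q.1.1 = x := hq
      exact q.2.symm.trans (by rw [hq'])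
    · intro q hq q' hq' hqq
      exact Subtype.ext (Prod.ext (hq.trans hq'.symm) hqq)
  · have h1 : MulAction.stabilizer G q =
        MulAction.stabilizer G q.1.2 ⊓ MulAction.stabilizer G q.1.1 := by
      ext a
      exact (Subtype.ext_iff.trans Prod.ext_iff).trans and_comm
    rw [h1]
    refine h.O_inf _ (Z.stab_mem (g q.1.2)) _ (hg.2 q.1.2) _ (X.stab_mem q.1.1) ?_
    rw [← q.2]
    exact GSetIn.stab_le f q.1.1

end fiberProd

theorem IsOHom.of_isPullback (h : IsMackeySystem C O) {P X Y Z : GSetIn C} {p : P ⟶ X}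
    {q : P ⟶ Y} {f : X ⟶ Z} {g : Y ⟶ Z} (sq : IsPullback p q f g) (hg : IsOHom O g) :
    IsOHom O p := by
  have e := sq.isoIsPullback_hom_fst _ _ (fiberProd.isPullback h f g)
  rw [← e]
  exact (fiberProd.isOHom_fst h f g hg).iso_comp _

/-- The disjoint union of two `G`-sets. -/
def coprod (X Y : GSetIn C) : GSetIn C where
  carrier := X ⊕ Y
  action :=
    { smul := fun a => Sum.map (a • ·) (a • ·)
      one_smul := by
        rintro (x | y)
        · exact congrArg Sum.inl (one_smul G x)
        · exact congrArg Sum.inr (one_smul G y)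
      mul_smul := by
        rintro a b (x | y)
        · exact congrArg Sum.inl (mul_smul a b x)
        · exact congrArg Sum.inr (mul_smul a b y) }
  stab_mem := by
    rintro (x | y)
    · convert X.stab_mem x using 1
      ext a
      exact Sum.inl_injective.eq_iff
    · convert Y.stab_mem y using 1
      ext a
      exact Sum.inr_injective.eq_iff

namespace coprod

variable (X Y : GSetIn C)

/-- The inclusion of the first summand. -/
def inl : X ⟶ coprod X Y where
  toFun := Sum.inl
  map_smul' _ _ := rfl

/-- The inclusion of the second summand. -/
def inr : Y ⟶ coprod X Y where
  toFun := Sum.inr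
  map_smul' _ _ := rfl

variable {X Y}

/-- The map `f ∪ g` out of a disjoint union. -/
def desc {Z : GSetIn C} (f : X ⟶ Z) (g : Y ⟶ Z) : coprod X Y ⟶ Z where
  toFun := Sum.elim f g
  map_smul' := by
    rintro a (x | y)
    · exact GSetIn.map_smul f a x
    · exact GSetIn.map_smul g a y

theorem isOHom_desc {Z : GSetIn C} {f : X ⟶ Z} {g : Y ⟶ Z} (hf : IsOHom O f)
    (hg : IsOHom O g) : IsOHom O (desc f g) := by
  refine ⟨fun z => ?_, ?_⟩
  · refine (((hf.1 z).image Sum.inl).union ((hg.1 z).image Sum.inr)).subset ?_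
    rintro (x | y) hz
    · exact Or.inl ⟨x, hz, rfl⟩
    · exact Or.inr ⟨y, hz, rfl⟩
  · rintro (x | y)
    · have e := GSetIn.stab_le (inl X Y) x
      have e' : MulAction.stabilizer G (inl X Y x) = MulAction.stabilizer G x := by
        ext a
        exact Sum.inl_injective.eq_iff
      have := hf.2 x
      rw [← e'] at this
      exact this
    · have e' : MulAction.stabilizer G (inr X Y y) = MulAction.stabilizer G y := by
        ext a
        exact Sum.inr_injective.eq_iff
      have := hg.2 y
      rw [← e'] at this
      exact this

variable (X Y)

/-- The family `(X, Y)`, indexed by a two-element type in `Type u`. -/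
def pair : ULift.{u} Bool → GSetIn C
  | ⟨true⟩ => X
  | ⟨false⟩ => Y

/-- The two inclusions. -/
def pairInj : ∀ b : ULift.{u} Bool, pair X Y b ⟶ coprod X Y
  | ⟨true⟩ => inl X Y
  | ⟨false⟩ => inr X Y

theorem isColimit : Nonempty (IsColimit (Cofan.mk (coprod X Y) (pairInj X Y))) :=
  ⟨Cofan.IsColimit.mk _
    (fun s => desc (s.inj ⟨true⟩) (s.inj ⟨false⟩))
    (by rintro s ⟨_ | _⟩ <;> rfl)
    (by
      intro s m hm
      refine MulActionHom.ext ?_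
      rintro (x | y)
      · exact congrArg (fun k : X ⟶ s.pt => k x) (hm ⟨true⟩)
      · exact congrArg (fun k : Y ⟶ s.pt => k y) (hm ⟨false⟩))⟩

end coprod

/-! ### Semi-Mackey functors -/

/-- The laws of a semi-Mackey functor on the Mackey system `(C, O)`: contravariant functoriality of
`res` on the category of `G`-sets with stabilizers in `C`, covariant functoriality of `tr` on the
subcategory attached to `(C, O)`, the Mackey condition and additivity. -/
structure IsSemiMackey (h : IsMackeySystem C O) (M : GSetIn C → Type w)
    [∀ X, CommMonoid (M X)]
    (res : ∀ {X Y : GSetIn C}, (X ⟶ Y) → (M Y →* M X))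
    (tr : ∀ {X Y : GSetIn C} (f : X ⟶ Y), IsOHom O f → (M X →* M Y)) : Prop where
  res_id : ∀ X : GSetIn C, res (𝟙 X) = MonoidHom.id (M X)
  res_comp : ∀ {X Y Z : GSetIn C} (f : X ⟶ Y) (g : Y ⟶ Z), res (f ≫ g) = (res f).comp (res g)
  tr_id : ∀ (X : GSetIn C) (hX : IsOHom O (𝟙 X)), tr (𝟙 X) hX = MonoidHom.id (M X)
  tr_comp : ∀ {X Y Z : GSetIn C} (f : X ⟶ Y) (g : Y ⟶ Z) (hf : IsOHom O f) (hg : IsOHom O g),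
    tr (f ≫ g) (hf.comp h hg) = (tr g hg).comp (tr f hf)
  mackey : ∀ {X' Y' X Y : GSetIn C} {g' : X' ⟶ Y'} {f' : X' ⟶ X} {f : Y' ⟶ Y} {g : X ⟶ Y}
    (sq : IsPullback g' f' f g) (hg : IsOHom O g),
    (res f).comp (tr g hg) = (tr g' (hg.of_isPullback h sq)).comp (res f')
  additive : ∀ {Λ : Type u} (X : Λ → GSetIn C) (Y : GSetIn C) (i : ∀ l, X l ⟶ Y),
    Nonempty (IsColimit (Cofan.mk Y i)) →
      Function.Bijective (fun (m : M Y) (l : Λ) => res (i l) m)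

/-- A semi-Mackey functor on the Mackey system `(C, O)`. -/
structure SemiMackeyFunctor (h : IsMackeySystem C O) where
  obj : GSetIn C → Type w
  [commMonoid : ∀ X, CommMonoid (obj X)]
  res : ∀ {X Y : GSetIn C}, (X ⟶ Y) → (obj Y →* obj X)
  tr : ∀ {X Y : GSetIn C} (f : X ⟶ Y), IsOHom O f → (obj X →* obj Y)
  isSemiMackey : IsSemiMackey h obj res tr

attribute [instance] SemiMackeyFunctor.commMonoid

theorem SemiMackeyFunctor.existsUnique_coprod {h : IsMackeySystem C O}
    (M : SemiMackeyFunctor.{u, w} h) {A B : GSetIn C} (a : M.obj A) (b : M.obj B) :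
    ∃! m : M.obj (coprod A B),
      M.res (coprod.inl A B) m = a ∧ M.res (coprod.inr A B) m = b := by
  have hb := M.isSemiMackey.additive _ _ _ (coprod.isColimit A B)
  let v : ∀ l : ULift.{u} Bool, M.obj (coprod.pair A B l) := fun l =>
    match l with
    | ⟨true⟩ => a
    | ⟨false⟩ => b
  obtain ⟨m, hm, hu⟩ := hb.existsUnique v
  refine ⟨m, ⟨congrFun hm ⟨true⟩, congrFun hm ⟨false⟩⟩, fun m' hm' => hu m' ?_⟩
  funext l
  rcases l with ⟨_ | _⟩
  · exact hm'.2
  · exact hm'.1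

/-- The element of `M(A ⨿ B)` with restrictions `a ∈ M(A)` and `b ∈ M(B)`. -/
noncomputable def SemiMackeyFunctor.glue {h : IsMackeySystem C O}
    (M : SemiMackeyFunctor.{u, w} h) {A B : GSetIn C} (a : M.obj A) (b : M.obj B) :
    M.obj (coprod A B) :=
  (M.existsUnique_coprod a b).choose

theorem SemiMackeyFunctor.glue_spec {h : IsMackeySystem C O}
    (M : SemiMackeyFunctor.{u, w} h) {A B : GSetIn C} (a : M.obj A) (b : M.obj B) :
    M.res (coprod.inl A B) (M.glue a b) = a ∧ M.res (coprod.inr A B) (M.glue a b) = b :=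
  (M.existsUnique_coprod a b).choose_spec.1

end General

/-! ### Tambara systems -/

/-- A Tambara system on `G`: a set `Ct` of subsets of `G`, and a Mackey system `(C, O)`, where `C`
is the set of the subgroups that belong to `Ct`. -/
structure TambaraSystem (G : Type u) [Group G] where
  Ct : Set (Set G)
  left_mem : ∀ A ∈ Ct, ∀ g : G, (fun x => g * x) '' A ∈ Ct
  right_mem : ∀ A ∈ Ct, ∀ g : G, (fun x => x * g) '' A ∈ Ct
  inter_mem : ∀ A ∈ Ct, ∀ B ∈ Ct, A ∩ B ∈ Ct
  union_mem : ∀ A ∈ Ct, ∀ B ∈ Ct, A ∪ B ∈ Ct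
  O : Subgroup G → Set (Subgroup G)
  isMackey : IsMackeySystem {H : Subgroup G | (H : Set G) ∈ Ct} O
  self_mem : ∀ H : Subgroup G, (H : Set G) ∈ Ct → H ∈ O H

namespace TambaraSystem

variable (T : TambaraSystem G)

/-- The subgroups that belong to the given set of subsets. -/
def C : Set (Subgroup G) := {H : Subgroup G | (H : Set G) ∈ T.Ct}

/-- The multiplicative Mackey system of a Tambara system. -/
theorem mulSys : IsMackeySystem T.C T.O := T.isMackey

/-- The additive Mackey system of a Tambara system. -/
theorem addSys : IsMackeySystem T.C (finO T.C) := by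
  refine isMackeySystem_finO T.isMackey.conj_mem T.isMackey.inf_mem

/-- A subgroup that is a finite union of left cosets of a member of `C` is in `C`. -/
theorem mem_C_of_finite {K H : Subgroup G} (hK : K ∈ T.C) (hKH : K ≤ H) {ι : Type*} [Finite ι]
    (φ : H → ι) (hφ : ∀ a b : H, φ a = φ b → (a : G)⁻¹ * b ∈ K) : H ∈ T.C := by
  classical
  have hfin : (Set.range φ).Finite := Set.toFinite _
  have hne : hfin.toFinset.Nonempty := ⟨φ 1, by simp⟩
  have hsup : SupClosed T.Ct := fun A hA B hB => T.union_mem A hA B hB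
  let r : ι → H := fun i => if hi : ∃ a, φ a = i then hi.choose else 1
  have hr : ∀ a, φ (r (φ a)) = φ a := fun a => by
    have hi : ∃ b, φ b = φ a := ⟨a, rfl⟩
    simp only [r, dif_pos hi]
    exact hi.choose_spec
  have := hsup.finsetSup'_mem hne (f := fun i => (fun x => (r i : G) * x) '' (K : Set G))
    (fun i _ => T.left_mem _ hK _)
  have e : (H : Set G) = hfin.toFinset.sup' hne
      (fun i => (fun x => (r i : G) * x) '' (K : Set G)) := by
    ext a
    rw [Finset.sup'_eq_sup, Finset.sup_set_eq_biUnion]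
    simp only [Set.mem_iUnion, Set.Finite.mem_toFinset]
    constructor
    · intro ha
      exact ⟨φ ⟨a, ha⟩, ⟨_, rfl⟩, _, hφ _ _ (hr ⟨a, ha⟩), by simp⟩
    · rintro ⟨i, -, k, hk, rfl⟩
      exact H.mul_mem (r i).2 (hKH hk)
  change (H : Set G) ∈ T.Ct
  rw [e]
  exact this

end TambaraSystem

section Exponential

variable {T : TambaraSystem G}

/-- The points of `Π_η(A)`: pairs of a point `y` of `Y` and a section `σ` of `p` over the fiber
`η⁻¹(y)`. -/
structure PiPt {X Y A : GSetIn T.C} (η : X ⟶ Y) (p : A ⟶ X) : Type u where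
  pt : Y
  sec : {x : X // η x = pt} → A
  p_sec : ∀ x, p (sec x) = x.1

namespace PiPt

variable {X Y A : GSetIn T.C} {η : X ⟶ Y} {p : A ⟶ X}

theorem ext_iff' {s t : PiPt η p} :
    s = t ↔ s.pt = t.pt ∧ ∀ x (hs : η x = s.pt) (ht : η x = t.pt), s.sec ⟨x, hs⟩ = t.sec ⟨x, ht⟩ := by
  constructor
  · rintro rfl
    exact ⟨rfl, fun _ _ _ => rfl⟩
  · rcases s with ⟨y, σ, hσ⟩
    rcases t with ⟨y', τ, hτ⟩
    rintro ⟨h, h'⟩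
    dsimp at h
    subst h
    have : σ = τ := funext fun x => h' x.1 x.2 x.2
    subst this
    rfl

theorem inv_smul_mem {y : Y} (a : G) {x : X} (hx : η x = a • y) : η (a⁻¹ • x) = y := by
  rw [GSetIn.map_smul, hx, inv_smul_smul]

/-- `G` acts by `a • (y, σ) = (a • y, a σ a⁻¹)`. -/
instance : MulAction G (PiPt η p) where
  smul a s :=
    { pt := a • s.pt
      sec := fun x => a • s.sec ⟨a⁻¹ • x.1, inv_smul_mem a x.2⟩
      p_sec := fun x => by rw [GSetIn.map_smul, s.p_sec, smul_inv_smul] }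
  one_smul s := by
    refine ext_iff'.2 ⟨one_smul G _, fun x hs ht => ?_⟩
    change (1 : G) • s.sec ⟨(1 : G)⁻¹ • x, _⟩ = _
    rw [one_smul]
    congr 2
    rw [inv_one, one_smul]
  mul_smul a b s := by
    refine ext_iff'.2 ⟨mul_smul a b _, fun x hs ht => ?_⟩
    change (a * b) • s.sec ⟨(a * b)⁻¹ • x, _⟩ = a • b • s.sec ⟨b⁻¹ • a⁻¹ • x, _⟩
    rw [mul_smul]
    congr 4
    rw [mul_inv_rev, mul_smul]

theorem smul_pt (a : G) (s : PiPt η p) : (a • s).pt = a • s.pt := rfl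

theorem smul_sec (a : G) (s : PiPt η p) (x : X) (hx : η x = s.pt) (hx' : η (a • x) = (a • s).pt) :
    (a • s).sec ⟨a • x, hx'⟩ = a • s.sec ⟨x, hx⟩ := by
  change a • s.sec ⟨a⁻¹ • a • x, _⟩ = _
  congr 2
  exact Subtype.ext (inv_smul_smul a x)

theorem stab_mem (hη : IsOHom T.O η) (s : PiPt η p) : MulAction.stabilizer G s ∈ T.C := by
  classical
  have hF : Finite {x : X // η x = s.pt} := hη.1 s.pt
  let F := {x : X // η x = s.pt}
  have hinf : ∀ t : Finset F, MulAction.stabilizer G s.pt ⊓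
      t.inf (fun x => MulAction.stabilizer G (s.sec x)) ∈ T.C := by
    intro t
    induction t using Finset.induction_on with
    | empty => simpa using Y.stab_mem s.pt
    | insert x t _ ih =>
      rw [Finset.inf_insert, inf_left_comm]
      exact T.mulSys.inf_mem _ (A.stab_mem _) _ ih
  have := Fintype.ofFinite F
  have hmem : ∀ {a : G}, a ∈ MulAction.stabilizer G s.pt ⊓
      Finset.univ.inf (fun x : F => MulAction.stabilizer G (s.sec x)) ↔
      a • s.pt = s.pt ∧ ∀ x : F, a • s.sec x = s.sec x := by
    intro a
    rw [Subgroup.mem_inf, Finset.inf_univ_eq_iInf, Subgroup.mem_iInf]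
    rfl
  have hstab : ∀ {a : G}, a ∈ MulAction.stabilizer G s → a • s.pt = s.pt := fun {a} ha =>
    congrArg PiPt.pt ha
  refine T.mem_C_of_finite (hinf Finset.univ) ?_ (ι := F → F)
    (fun a x => ⟨(a : G) • x.1, by rw [GSetIn.map_smul, x.2, hstab a.2]⟩) ?_
  · intro a ha
    obtain ⟨h1, h2⟩ := hmem.1 ha
    refine ext_iff'.2 ⟨h1, fun x hs ht => ?_⟩
    have hx : a⁻¹ • x = x := by
      have h3 := congrArg (fun b : A => p b) (h2 ⟨x, ht⟩)
      simp only [GSetIn.map_smul, s.p_sec] at h3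
      rw [inv_smul_eq_iff, h3]
    change a • s.sec ⟨a⁻¹ • x, _⟩ = _
    rw [← h2 ⟨x, ht⟩]
    congr 3
  · intro a b hab
    have hxx : ∀ x : F, (a : G) • x.1 = (b : G) • x.1 := fun x =>
      congrArg Subtype.val (congrFun hab x)
    have key : ∀ c ∈ MulAction.stabilizer G s, ∀ x (hx : η x = s.pt) (hx' : η (c • x) = s.pt),
        s.sec ⟨c • x, hx'⟩ = c • s.sec ⟨x, hx⟩ := by
      intro c hc x hx hx'
      rw [← smul_sec c s x hx (by rw [GSetIn.map_smul, hx]; rfl)]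
      exact ((ext_iff'.1 hc).2 _ _ _).symm
    refine hmem.2 ⟨?_, fun x => ?_⟩
    · rw [mul_smul, hstab b.2, inv_smul_eq_iff, hstab a.2]
    · rw [mul_smul, inv_smul_eq_iff]
      have hb : η ((b : G) • x.1) = s.pt := by rw [GSetIn.map_smul, x.2, hstab b.2]
      have ha : η ((a : G) • x.1) = s.pt := by rw [GSetIn.map_smul, x.2, hstab a.2]
      rw [← key b b.2 x.1 x.2 hb, ← key a a.2 x.1 x.2 ha]
      congr 2
      exact (hxx x).symm

end PiPt

variable {X Y A : GSetIn T.C}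

/-- The `G`-set `Π_η(A)`. -/
def piObj (η : X ⟶ Y) (hη : IsOHom T.O η) (p : A ⟶ X) : GSetIn T.C where
  carrier := PiPt η p
  stab_mem := PiPt.stab_mem hη

/-- The projection `π : Π_η(A) ⟶ Y`. -/
def piProj (η : X ⟶ Y) (hη : IsOHom T.O η) (p : A ⟶ X) : piObj η hη p ⟶ Y where
  toFun s := PiPt.pt s
  map_smul' _ _ := rfl

theorem isOHom_piProj {η : X ⟶ Y} (hη : IsOHom T.O η) {p : A ⟶ X}
    (hp : IsOHom (finO T.C) p) : IsOHom (finO T.C) (piProj η hη p) := by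
  refine isOHom_finO _ fun y => ?_
  have : Finite {x : X // η x = y} := hη.1 y
  have : ∀ x : {x : X // η x = y}, Finite {a : A // p a = x.1} := fun x => hp.1 x.1
  refine Finite.of_injective (β := ∀ x : {x : X // η x = y}, {a : A // p a = x.1})
    (fun s x => ⟨PiPt.sec s.1 ⟨x.1, x.2.trans s.2.symm⟩, PiPt.p_sec s.1 _⟩) ?_
  intro s t hst
  refine Subtype.ext (PiPt.ext_iff'.2 ⟨s.2.trans t.2.symm, fun x hs ht => ?_⟩)
  exact congrArg Subtype.val (congrFun hst ⟨x, hs.trans s.2⟩)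

/-- The evaluation `λ : X ×_Y Π_η(A) ⟶ A`, `(x, (y, σ)) ↦ σ(x)`. -/
def piEval (η : X ⟶ Y) (hη : IsOHom T.O η) (p : A ⟶ X) :
    fiberProd T.mulSys η (piProj η hη p) ⟶ A where
  toFun q := PiPt.sec q.1.2 ⟨q.1.1, q.2⟩
  map_smul' a q := PiPt.smul_sec a q.1.2 q.1.1 q.2 _

/-- The exponential diagrams
```
X <-ξ- Z <-ζ- X'
|η            |η'
v             v
Y <-----υ---- Y'
```
are those isomorphic, over `η`, to `X <-p- A <-λ- X ×_Y Π_η(A) -ρ-> Π_η(A) -π-> Y` for some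
morphism `p` with finite fibers; here `η` is a morphism for `(C, O)`. -/
def IsExponential {X Y Z X' Y' : GSetIn T.C} (η : X ⟶ Y) (ξ : Z ⟶ X) (ζ : X' ⟶ Z)
    (η' : X' ⟶ Y') (υ : Y' ⟶ Y) : Prop :=
  ∃ (hη : IsOHom T.O η) (A : GSetIn T.C) (p : A ⟶ X) (_ : IsOHom (finO T.C) p)
    (eZ : Z ≅ A) (eX : X' ≅ fiberProd T.mulSys η (piProj η hη p)) (eY : Y' ≅ piObj η hη p),
    eZ.hom ≫ p = ξ ∧
    eX.hom ≫ piEval η hη p = ζ ≫ eZ.hom ∧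
    eX.hom ≫ fiberProd.snd T.mulSys η (piProj η hη p) = η' ≫ eY.hom ∧
    eY.hom ≫ piProj η hη p = υ

theorem isExponential_pi {η : X ⟶ Y} (hη : IsOHom T.O η) {p : A ⟶ X}
    (hp : IsOHom (finO T.C) p) :
    IsExponential η p (piEval η hη p) (fiberProd.snd T.mulSys η (piProj η hη p))
      (piProj η hη p) :=
  ⟨hη, A, p, hp, Iso.refl _, Iso.refl _, Iso.refl _, by simp⟩

namespace IsExponential

variable {X Y Z X' Y' : GSetIn T.C} {η : X ⟶ Y} {ξ : Z ⟶ X} {ζ : X' ⟶ Z} {η' : X' ⟶ Y'}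
  {υ : Y' ⟶ Y}

theorem isOHom_eta (h : IsExponential η ξ ζ η' υ) : IsOHom T.O η := h.choose

theorem isOHom_xi (h : IsExponential η ξ ζ η' υ) : IsOHom (finO T.C) ξ := by
  obtain ⟨hη, A, p, hp, eZ, eX, eY, h1, h2, h3, h4⟩ := h
  exact h1 ▸ hp.iso_comp eZ

theorem isOHom_upsilon (h : IsExponential η ξ ζ η' υ) : IsOHom (finO T.C) υ := by
  obtain ⟨hη, A, p, hp, eZ, eX, eY, h1, h2, h3, h4⟩ := h
  exact h4 ▸ (isOHom_piProj hη hp).iso_comp eY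

theorem isOHom_eta' (h : IsExponential η ξ ζ η' υ) : IsOHom T.O η' := by
  obtain ⟨hη, A, p, hp, eZ, eX, eY, h1, h2, h3, h4⟩ := h
  have e : η' = (eX.hom ≫ fiberProd.snd T.mulSys η (piProj η hη p)) ≫ eY.symm.hom := by
    rw [h3]; simp
  rw [e]
  exact ((hη.of_isPullback T.mulSys (fiberProd.isPullback T.mulSys η _).flip).iso_comp
    eX).comp_iso eY.symm

end IsExponential

end Exponential

/-! ### Semi-Tambara functors -/

/-- The data that make a family of commutative semirings `S(X)` a semi-Tambara functor on `T`:
restrictions `res`, additive transfers `tr` and multiplicative transfers `norm`, such that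
`(res, tr)` is a semi-Mackey functor on `(C, O_C)` for the additive monoids, `(res, norm)` is a
semi-Mackey functor on `(C, O)` for the multiplicative monoids, and the exponential (distributive)
condition holds. -/
structure SemiTambaraStructure (T : TambaraSystem G) (S : GSetIn T.C → Type w)
    [∀ X, CommSemiring (S X)] where
  res : ∀ {X Y : GSetIn T.C}, (X ⟶ Y) → (S Y →+* S X)
  tr : ∀ {X Y : GSetIn T.C} (f : X ⟶ Y), IsOHom (finO T.C) f → (S X →+ S Y)
  norm : ∀ {X Y : GSetIn T.C} (f : X ⟶ Y), IsOHom T.O f → (S X →* S Y)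
  additive : IsSemiMackey T.addSys (fun X => Multiplicative (S X))
    (fun f => AddMonoidHom.toMultiplicative (res f).toAddMonoidHom)
    (fun f hf => AddMonoidHom.toMultiplicative (tr f hf))
  multiplicative : IsSemiMackey T.mulSys S (fun f => (res f).toMonoidHom) norm
  exponential : ∀ {X Y Z X' Y' : GSetIn T.C} {η : X ⟶ Y} {ξ : Z ⟶ X} {ζ : X' ⟶ Z}
    {η' : X' ⟶ Y'} {υ : Y' ⟶ Y} (h : IsExponential η ξ ζ η' υ) (s : S Z),
    tr υ h.isOHom_upsilon (norm η' h.isOHom_eta' (res ζ s)) =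
      norm η h.isOHom_eta (tr ξ h.isOHom_xi s)

/-! ### The semirings `S_M(X)` -/

section Tambarization

variable {T : TambaraSystem G} (M : SemiMackeyFunctor.{u, w} T.mulSys)

/-- Objects of the category `M`-`G/X`: pairs of a morphism `p : A ⟶ X` with finite fibers and an
element `m ∈ M(A)`. -/
structure MObj (X : GSetIn T.C) where
  A : GSetIn T.C
  p : A ⟶ X
  hp : IsOHom (finO T.C) p
  m : M.obj A

variable {M}

/-- Morphisms of `M`-`G/X`. -/
@[ext]
structure MHom {X : GSetIn T.C} (a b : MObj M X) where
  f : a.A ⟶ b.A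
  w : f ≫ b.p = a.p
  res_m : M.res f b.m = a.m

instance {X : GSetIn T.C} : Category (MObj M X) where
  Hom a b := MHom a b
  id a := ⟨𝟙 a.A, Category.id_comp _, by rw [M.isSemiMackey.res_id]; rfl⟩
  comp k l := ⟨k.f ≫ l.f, by rw [Category.assoc, l.w, k.w], by
    rw [M.isSemiMackey.res_comp, MonoidHom.comp_apply, l.res_m, k.res_m]⟩
  id_comp k := MHom.ext (Category.id_comp _)
  comp_id k := MHom.ext (Category.comp_id _)
  assoc k l n := MHom.ext (Category.assoc _ _ _)

namespace MObj

variable {X Y : GSetIn T.C}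

/-- The sum `(A ⨿ B ⟶ X, m_A ⨿ m_B)`. -/
noncomputable def sum (a b : MObj M X) : MObj M X where
  A := coprod a.A b.A
  p := coprod.desc a.p b.p
  hp := coprod.isOHom_desc a.hp b.hp
  m := M.glue a.m b.m

/-- The product `(A ×_X B ⟶ X, M^*(ϖ₁)(m_A) · M^*(ϖ₂)(m_B))`. -/
def prod (a b : MObj M X) : MObj M X where
  A := fiberProd T.mulSys a.p b.p
  p := fiberProd.fst T.mulSys a.p b.p ≫ a.p
  hp := (b.hp.of_isPullback T.addSys (fiberProd.isPullback T.mulSys a.p b.p)).comp T.addSys a.hp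
  m := M.res (fiberProd.fst T.mulSys a.p b.p) a.m * M.res (fiberProd.snd T.mulSys a.p b.p) b.m

/-- `(A' ⟶ Y, M^*(ζ')(m_A))`, for a pull-back `A'` of `p : A ⟶ X` along `ζ : Y ⟶ X`. -/
def pull (a : MObj M X) {ζ : Y ⟶ X} {A' : GSetIn T.C} {p' : A' ⟶ Y} {ζ' : A' ⟶ a.A}
    (sq : IsPullback p' ζ' ζ a.p) : MObj M Y where
  A := A'
  p := p'
  hp := a.hp.of_isPullback T.addSys sq
  m := M.res ζ' a.m

/-- `(A ⟶ X ⟶ Y, m_A)`. -/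
def post (a : MObj M X) (ξ : X ⟶ Y) (hξ : IsOHom (finO T.C) ξ) : MObj M Y where
  A := a.A
  p := a.p ≫ ξ
  hp := a.hp.comp T.addSys hξ
  m := a.m

/-- `(Y' ⟶ Y, M_*(ρ) M^*(λ) (m_A))`, for an exponential diagram on `η : X ⟶ Y` and
`p : A ⟶ X`. -/
def expo (a : MObj M X) {η : X ⟶ Y} {X' Y' : GSetIn T.C} {l : X' ⟶ a.A} {ρ : X' ⟶ Y'}
    {υ : Y' ⟶ Y} (h : IsExponential η a.p l ρ υ) : MObj M Y where
  A := Y'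
  p := υ
  hp := h.isOHom_upsilon
  m := M.tr ρ h.isOHom_eta' (M.res l a.m)

end MObj

variable (M)

/-- `S_M(X)`: the isomorphism classes of objects of `M`-`G/X`. -/
def SM (X : GSetIn T.C) : Type (max (u + 1) w) := Quotient (isIsomorphicSetoid (MObj M X))

variable {M}

/-- The isomorphism class of an object of `M`-`G/X`. -/
def SM.mk {X : GSetIn T.C} (a : MObj M X) : SM M X := Quotient.mk _ a

end Tambarization

end Tambarization

open Tambarization (GSetIn MObj SM IsOHom finO IsExponential TambaraSystem SemiMackeyFunctor
  SemiTambaraStructure)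

/-! The laws for $M^*$ and $\xi_+$ come from pasting pull-back squares; the substance lies in the
multiplicative transfers, which are defined through $\Pi_\eta(A)$. An exponential diagram on $\eta$
is characterized by a property of points, `IsExp`: $X'$ is $X\times_Y Y'$, and the points of $Y'$
over $y$ are the sections of $\xi$ over $\eta^{-1}(y)$. Conversely this property determines the
diagram up to isomorphism (`IsExp.exists_iso_pi`, `IsExp.exists_iso`). So $\eta_\bullet$ may be
computed with whichever diagram is convenient (`normFun_mk`), just as $\zeta^*$ may be computed with
any pull-back (`resFun_mk`).

Each law for $\eta_\bullet$ then rests on a statement about sections. A section over a fiber of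
$\theta\eta$ is a family of sections over fibers of $\eta$ (`IsExp.comp`, functoriality). A section
of $A\times_X B$ is a pair of sections (`IsExp.prod`, multiplicativity). Fibers do not change under
base change (`IsExp.baseChange`, Mackey condition). A section of a composite is a section together
with a lift of it (`IsExp.trans`, exponential condition). In the first three cases the elements of
$M$ are matched by the Mackey condition of $M$ on a pull-back square inside the new diagram; in the
last, functoriality of $M^*$ suffices.

Additivity holds because an object over a disjoint union is the same as a family of objects over the
summands, and $M$ is additive (`exists_glue`). -/

namespace Tambarization

/-! ### Isomorphisms, pull-backs and disjoint unions of $G$-sets on points -/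

section Pointwise

variable {G : Type u} [Group G] {C : Set (Subgroup G)} {O : Subgroup G → Set (Subgroup G)}

namespace GSetIn

theorem hom_ext {X Y : GSetIn C} {f g : X ⟶ Y} (h : ∀ x : X, f x = g x) : f = g :=
  MulActionHom.ext h

theorem congr_hom {X Y : GSetIn C} {f g : X ⟶ Y} (h : f = g) (x : X) : f x = g x := by rw [h]

theorem comp_app {X Y Z : GSetIn C} (f : X ⟶ Y) (g : Y ⟶ Z) (x : X) : (f ≫ g) x = g (f x) := rfl

/-- An equivariant bijection is an isomorphism. -/
noncomputable def isoOfBijective {X Y : GSetIn C} (f : X ⟶ Y)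
    (hf : Function.Bijective (fun x : X => f x)) : X ≅ Y where
  hom := f
  inv :=
    { toFun := (Equiv.ofBijective _ hf).symm
      map_smul' := fun a y => hf.1 (by
        change f _ = f (a • _)
        rw [map_smul]
        exact ((Equiv.ofBijective _ hf).apply_symm_apply _).trans
          (congrArg (a • ·) ((Equiv.ofBijective _ hf).apply_symm_apply y)).symm) }
  hom_inv_id := hom_ext fun x => (Equiv.ofBijective _ hf).symm_apply_apply x
  inv_hom_id := hom_ext fun y => (Equiv.ofBijective _ hf).apply_symm_apply y

theorem inv_hom_app {X Y : GSetIn C} (e : X ≅ Y) (y : Y) : e.hom (e.inv y) = y :=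
  congr_hom e.inv_hom_id y

theorem iso_bijective {X Y : GSetIn C} (e : X ≅ Y) : Function.Bijective (fun x : X => e.hom x) :=
  ⟨iso_inj e, fun y => ⟨e.inv y, inv_hom_app e y⟩⟩

/-- The hypotheses say that the comparison map to the explicit fibered product is an equivariant
bijection, hence an isomorphism. -/
theorem isPullback_of_forall (h : IsMackeySystem C O) {P X Y Z : GSetIn C} {u : P ⟶ X} {v : P ⟶ Y}
    {f : X ⟶ Z} {g : Y ⟶ Z} (w : ∀ p : P, f (u p) = g (v p))
    (inj : ∀ p q : P, u p = u q → v p = v q → p = q)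
    (surj : ∀ (x : X) (y : Y), f x = g y → ∃ p : P, u p = x ∧ v p = y) : IsPullback u v f g := by
  have w' : u ≫ f = v ≫ g := hom_ext w
  let k : P ⟶ fiberProd h f g := (fiberProd.isPullback h f g).lift u v w'
  have hk1 : k ≫ fiberProd.fst h f g = u := (fiberProd.isPullback h f g).lift_fst u v w'
  have hk2 : k ≫ fiberProd.snd h f g = v := (fiberProd.isPullback h f g).lift_snd u v w'
  have hk : Function.Bijective (fun p : P => k p) := by
    refine ⟨fun p q hpq => inj p q ?_ ?_, fun q => ?_⟩
    · rw [← hk1, comp_app, comp_app]; exact congrArg _ hpq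
    · rw [← hk2, comp_app, comp_app]; exact congrArg _ hpq
    · obtain ⟨p, h1, h2⟩ := surj q.1.1 q.1.2 q.2
      exact ⟨p, Subtype.ext (Prod.ext ((congr_hom hk1 p).trans h1) ((congr_hom hk2 p).trans h2))⟩
  exact IsPullback.of_iso (fiberProd.isPullback h f g) (isoOfBijective k hk).symm (Iso.refl _)
    (Iso.refl _) (Iso.refl _)
    (by rw [Iso.refl_hom, Category.comp_id, Iso.symm_hom, Iso.eq_inv_comp]; exact hk1)
    (by rw [Iso.refl_hom, Category.comp_id, Iso.symm_hom, Iso.eq_inv_comp]; exact hk2)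
    (by simp) (by simp)

/-- An arbitrary pull-back is isomorphic to `fiberProd`, whose points are pairs. Together with
`pullback_surj` this allows element chases in pull-back squares that are not given by a formula. -/
theorem pullback_inj (h : IsMackeySystem C O) {P X Y Z : GSetIn C} {u : P ⟶ X} {v : P ⟶ Y}
    {f : X ⟶ Z} {g : Y ⟶ Z} (sq : IsPullback u v f g) {p q : P} (h1 : u p = u q)
    (h2 : v p = v q) : p = q := by
  let e := sq.isoIsPullback _ _ (fiberProd.isPullback h f g)
  have e1 : e.hom ≫ fiberProd.fst h f g = u := sq.isoIsPullback_hom_fst _ _ _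
  have e2 : e.hom ≫ fiberProd.snd h f g = v := sq.isoIsPullback_hom_snd _ _ _
  refine iso_inj e (Subtype.ext (Prod.ext ?_ ?_))
  · rw [← e1] at h1; exact h1
  · rw [← e2] at h2; exact h2

theorem pullback_surj (h : IsMackeySystem C O) {P X Y Z : GSetIn C} {u : P ⟶ X} {v : P ⟶ Y}
    {f : X ⟶ Z} {g : Y ⟶ Z} (sq : IsPullback u v f g) {x : X} {y : Y} (hxy : f x = g y) :
    ∃ p : P, u p = x ∧ v p = y := by
  let e := sq.isoIsPullback _ _ (fiberProd.isPullback h f g)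
  have e1 : e.inv ≫ u = fiberProd.fst h f g := sq.isoIsPullback_inv_fst _ _ _
  have e2 : e.inv ≫ v = fiberProd.snd h f g := sq.isoIsPullback_inv_snd _ _ _
  let q : fiberProd h f g := ⟨(x, y), hxy⟩
  exact ⟨e.inv q, congr_hom e1 q, congr_hom e2 q⟩

theorem pullback_w {P X Y Z : GSetIn C} {u : P ⟶ X} {v : P ⟶ Y}
    {f : X ⟶ Z} {g : Y ⟶ Z} (sq : IsPullback u v f g) (p : P) : f (u p) = g (v p) :=
  congr_hom sq.w p

end GSetIn

theorem isOHom_finO_id (X : GSetIn C) : IsOHom (finO C) (𝟙 X) :=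
  isOHom_finO _ fun y => (Set.finite_singleton y).subset fun _ hx => hx

/-! ### Disjoint unions of families -/

/-- The disjoint union of a family of `G`-sets. -/
def sigmaObj {L : Type u} (X : L → GSetIn C) : GSetIn C where
  carrier := Σ l, X l
  action :=
    { smul := fun a s => ⟨s.1, a • s.2⟩
      one_smul := fun s => Sigma.ext rfl (heq_of_eq (one_smul G s.2))
      mul_smul := fun a b s => Sigma.ext rfl (heq_of_eq (mul_smul a b s.2)) }
  stab_mem := by
    rintro ⟨l, x⟩
    convert (X l).stab_mem x using 1
    ext a
    exact (sigma_mk_injective (i := l)).eq_iff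

namespace sigmaObj

variable {L : Type u} (X : L → GSetIn C)

/-- The inclusion of a summand. -/
def ι (l : L) : X l ⟶ sigmaObj X where
  toFun x := ⟨l, x⟩
  map_smul' _ _ := rfl

variable {X}

/-- The map out of a disjoint union given by a family of maps. -/
def desc {Z : GSetIn C} (f : ∀ l, X l ⟶ Z) : sigmaObj X ⟶ Z where
  toFun s := f s.1 s.2
  map_smul' a s := GSetIn.map_smul (f s.1) a s.2

variable (X) in
theorem isColimit : Nonempty (IsColimit (Cofan.mk (sigmaObj X) (ι X))) :=
  ⟨Cofan.IsColimit.mk _ (fun s => desc s.inj) (fun _ _ => rfl) fun s _ hm =>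
    MulActionHom.ext fun x => congrArg (fun k : X x.1 ⟶ s.pt => k x.2) (hm x.1)⟩

/-- The colimit cofans are those that are disjoint unions on points. -/
theorem bijective_of_isColimit {Y : GSetIn C} {i : ∀ l, X l ⟶ Y}
    (h : Nonempty (IsColimit (Cofan.mk Y i))) :
    Function.Bijective (fun s : sigmaObj X => desc i s) := by
  obtain ⟨hY⟩ := h
  obtain ⟨hS⟩ := isColimit X
  have e : (hS.coconePointUniqueUpToIso hY).hom = desc i := by
    refine hS.hom_ext fun ⟨l⟩ => ?_
    rw [hS.comp_coconePointUniqueUpToIso_hom]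
    rfl
  exact e ▸ GSetIn.iso_bijective (hS.coconePointUniqueUpToIso hY)

end sigmaObj

/-! ### Values of semi-Mackey functors -/

namespace SemiMackeyFunctor

variable {h : IsMackeySystem C O} (M : SemiMackeyFunctor.{u, w} h)

theorem res_id_apply {X : GSetIn C} (m : M.obj X) : M.res (𝟙 X) m = m := by
  rw [M.isSemiMackey.res_id]; rfl

theorem res_comp_apply {X Y Z : GSetIn C} (f : X ⟶ Y) (g : Y ⟶ Z) (m : M.obj Z) :
    M.res (f ≫ g) m = M.res f (M.res g m) := by
  rw [M.isSemiMackey.res_comp]; rfl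

theorem tr_comp_apply {X Y Z : GSetIn C} (f : X ⟶ Y) (g : Y ⟶ Z) (hf : IsOHom O f)
    (hg : IsOHom O g) (hfg : IsOHom O (f ≫ g)) (m : M.obj X) :
    M.tr (f ≫ g) hfg m = M.tr g hg (M.tr f hf m) := by
  rw [M.isSemiMackey.tr_comp f g hf hg]; rfl

theorem tr_id_apply {X : GSetIn C} (hX : IsOHom O (𝟙 X)) (m : M.obj X) : M.tr (𝟙 X) hX m = m := by
  rw [M.isSemiMackey.tr_id]; rfl

theorem res_tr {X' Y' X Y : GSetIn C} {g' : X' ⟶ Y'} {f' : X' ⟶ X} {f : Y' ⟶ Y} {g : X ⟶ Y}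
    (sq : IsPullback g' f' f g) (hg : IsOHom O g) (hg' : IsOHom O g') (m : M.obj X) :
    M.res f (M.tr g hg m) = M.tr g' hg' (M.res f' m) :=
  DFunLike.congr_fun (M.isSemiMackey.mackey sq hg) m

/-- An equivariant bijection from the explicit disjoint union transports its colimit property to
$Y$, so that additivity applies. -/
theorem sigma_bijective {L : Type u} {X : L → GSetIn C} {Y : GSetIn C} {i : ∀ l, X l ⟶ Y}
    (hi : Function.Bijective (fun s : sigmaObj X => sigmaObj.desc i s)) :
    Function.Bijective (fun (m : M.obj Y) (l : L) => M.res (i l) m) := by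
  exact M.isSemiMackey.additive X Y i ⟨(sigmaObj.isColimit X).some.ofIsoColimit (Cofan.ext (GSetIn.isoOfBijective (sigmaObj.desc i) hi) fun _ => rfl)⟩

theorem res_inl_glue {A B : GSetIn C} (a : M.obj A) (b : M.obj B) :
    M.res (coprod.inl A B) (M.glue a b) = a := (M.glue_spec a b).1

theorem res_inr_glue {A B : GSetIn C} (a : M.obj A) (b : M.obj B) :
    M.res (coprod.inr A B) (M.glue a b) = b := (M.glue_spec a b).2

end SemiMackeyFunctor

end Pointwise

/-! ### Exponential diagrams characterized by their points -/

section ExponentialPointwise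

open GSetIn hiding map_smul

variable {G : Type u} [Group G] {T : TambaraSystem G}

/-- The exponential diagrams, described on points: `X'` is the fibered product of `X` and `Y'`
over `Y`, and the points of `Y'` over `y` are the sections of `ξ` over `η⁻¹(y)`. -/
structure IsExp {X Y Z X' Y' : GSetIn T.C} (η : X ⟶ Y) (ξ : Z ⟶ X) (ζ : X' ⟶ Z)
    (η' : X' ⟶ Y') (υ : Y' ⟶ Y) : Prop where
  sq : IsPullback (ζ ≫ ξ) η' η υ
  -- The section that belongs to $y'$ sends $\xi(\zeta(x'))$ to $\zeta(x')$ for $x'$ in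
  -- $\eta'^{-1}(y')$. Phrasing it through points of $X'$ avoids choosing lifts and transporting
  -- between fibers.
  inj : ∀ y₁ y₂ : Y', υ y₁ = υ y₂ → (∀ x₁ x₂ : X', η' x₁ = y₁ → η' x₂ = y₂ →
    ξ (ζ x₁) = ξ (ζ x₂) → ζ x₁ = ζ x₂) → y₁ = y₂
  surj : ∀ (y : Y) (σ : ∀ x : X, η x = y → Z), (∀ x hx, ξ (σ x hx) = x) →
    ∃ y' : Y', υ y' = y ∧ ∀ (x' : X') (x : X) (hx : η x = y), η' x' = y' → ξ (ζ x') = x →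
      ζ x' = σ x hx

theorem piEval_comp {X Y A : GSetIn T.C} {η : X ⟶ Y} (hη : IsOHom T.O η) (p : A ⟶ X) :
    piEval η hη p ≫ p = fiberProd.fst T.mulSys η (piProj η hη p) :=
  hom_ext fun q => PiPt.p_sec q.1.2 ⟨q.1.1, q.2⟩

theorem isExp_pi {X Y A : GSetIn T.C} {η : X ⟶ Y} (hη : IsOHom T.O η) (p : A ⟶ X) :
    IsExp η p (piEval η hη p) (fiberProd.snd T.mulSys η (piProj η hη p)) (piProj η hη p) where
  sq := by rw [piEval_comp]; exact fiberProd.isPullback _ _ _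
  inj := by
    intro s t h1 h2
    refine PiPt.ext_iff'.2 ⟨h1, fun x hs ht => ?_⟩
    let q1 : fiberProd T.mulSys η (piProj η hη p) := ⟨(x, s), hs⟩
    let q2 : fiberProd T.mulSys η (piProj η hη p) := ⟨(x, t), ht⟩
    refine h2 q1 q2 rfl rfl ?_
    exact (PiPt.p_sec s ⟨x, hs⟩).trans (PiPt.p_sec t ⟨x, ht⟩).symm
  surj := by
    intro y σ hσ
    refine ⟨(⟨y, fun x => σ x.1 x.2, fun x => hσ _ _⟩ : PiPt η p), rfl, ?_⟩
    rintro ⟨⟨x', s⟩, hq⟩ x hx h1 h2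
    obtain rfl : x' = x := (PiPt.p_sec s ⟨x', hq⟩).symm.trans h2
    change s = _ at h1
    subst h1
    rfl

theorem IsExp.of_iso {X Y Z X' Y' Z₁ X₁ Y₁ : GSetIn T.C} {η : X ⟶ Y} {ξ : Z ⟶ X} {ζ : X' ⟶ Z}
    {η' : X' ⟶ Y'} {υ : Y' ⟶ Y} {ξ₁ : Z₁ ⟶ X} {ζ₁ : X₁ ⟶ Z₁} {η₁ : X₁ ⟶ Y₁} {υ₁ : Y₁ ⟶ Y}
    (h : IsExp η ξ₁ ζ₁ η₁ υ₁) (eZ : Z ≅ Z₁) (eX : X' ≅ X₁) (eY : Y' ≅ Y₁)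
    (h1 : eZ.hom ≫ ξ₁ = ξ) (h2 : eX.hom ≫ ζ₁ = ζ ≫ eZ.hom) (h3 : eX.hom ≫ η₁ = η' ≫ eY.hom)
    (h4 : eY.hom ≫ υ₁ = υ) : IsExp η ξ ζ η' υ := by
  subst h1 h4
  have h2' : ∀ x, ζ₁ (eX.hom x) = eZ.hom (ζ x) := congr_hom h2
  have h3' : ∀ x, η₁ (eX.hom x) = eY.hom (η' x) := congr_hom h3
  refine ⟨?_, fun y₁ y₂ hy hx => ?_, fun y σ hσ => ?_⟩
  · refine IsPullback.of_iso h.sq eX.symm (Iso.refl _) eY.symm (Iso.refl _) ?_ ?_ ?_ ?_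
    · simp only [Iso.symm_hom, Iso.refl_hom, Category.comp_id, Iso.eq_inv_comp]
      rw [← Category.assoc, h2, Category.assoc]
    · simp only [Iso.symm_hom, Iso.eq_inv_comp, ← Category.assoc, h3]
      simp
    · simp
    · simp
  · refine iso_inj eY (h.inj _ _ hy fun x₁ x₂ e1 e2 e => ?_)
    obtain ⟨x₁, rfl⟩ := (iso_bijective eX).2 x₁
    obtain ⟨x₂, rfl⟩ := (iso_bijective eX).2 x₂
    simp only [h2', h3'] at e1 e2 e ⊢
    rw [hx x₁ x₂ (iso_inj eY e1) (iso_inj eY e2) e]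
  · obtain ⟨y', hy', hs⟩ := h.surj y (fun x hx => eZ.hom (σ x hx)) hσ
    refine ⟨eY.inv y', (congr_hom (eY.inv_hom_id_assoc υ₁) y').trans hy',
      fun x' x hx e1 e2 => iso_inj eZ ?_⟩
    refine (h2' x').symm.trans (hs (eX.hom x') x hx ?_ ?_)
    · rw [h3', e1, inv_hom_app]
    · rw [h2']; exact e2

theorem IsExponential.isExp {X Y Z X' Y' : GSetIn T.C} {η : X ⟶ Y} {ξ : Z ⟶ X} {ζ : X' ⟶ Z}
    {η' : X' ⟶ Y'} {υ : Y' ⟶ Y} (h : IsExponential η ξ ζ η' υ) : IsExp η ξ ζ η' υ := by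
  obtain ⟨hη, A, p, hp, eZ, eX, eY, h1, h2, h3, h4⟩ := h
  exact (isExp_pi hη p).of_iso eZ eX eY h1 h2 h3 h4

namespace IsExp

variable {X Y Z X' Y' : GSetIn T.C} {η : X ⟶ Y} {ξ : Z ⟶ X} {ζ : X' ⟶ Z}
  {η' : X' ⟶ Y'} {υ : Y' ⟶ Y}

theorem w (h : IsExp η ξ ζ η' υ) (x : X') : η (ξ (ζ x)) = υ (η' x) := pullback_w h.sq x

theorem ext (h : IsExp η ξ ζ η' υ) {x₁ x₂ : X'} (h1 : ξ (ζ x₁) = ξ (ζ x₂))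
    (h2 : η' x₁ = η' x₂) : x₁ = x₂ := pullback_inj T.mulSys h.sq h1 h2

theorem exists_point (h : IsExp η ξ ζ η' υ) {x : X} {y : Y'} (hxy : η x = υ y) :
    ∃ x' : X', ξ (ζ x') = x ∧ η' x' = y := pullback_surj T.mulSys h.sq hxy

/-- A point of $Y'$ is sent to its image in $Y$ with its section; `inj` and `surj` make this a
bijection onto $\Pi_\eta(Z)$. The isomorphism for $X'$ follows, since both sides are pull-backs. -/
theorem exists_iso_pi (h : IsExp η ξ ζ η' υ) (hη : IsOHom T.O η) :
    ∃ (eX : X' ≅ fiberProd T.mulSys η (piProj η hη ξ)) (eY : Y' ≅ piObj η hη ξ),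
      eX.hom ≫ piEval η hη ξ = ζ ∧
      eX.hom ≫ fiberProd.snd T.mulSys η (piProj η hη ξ) = η' ≫ eY.hom ∧
      eY.hom ≫ piProj η hη ξ = υ := by
  -- `pt y x` is the point of $X'$ over the pair $(x,y)$. It is unique, by `h.ext`, and this is why
  -- the map built from it is equivariant although it comes from a choice.
  choose pt h1 h2 using fun (y : Y') (x : X) (hx : η x = υ y) => h.exists_point hx
  have hpt : ∀ x' y hx, η' x' = y → pt y (ξ (ζ x')) hx = x' := fun x' y hx e =>
    h.ext (h1 _ _ _) ((h2 _ _ _).trans e.symm)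
  let k : Y' ⟶ piObj η hη ξ :=
    { toFun := fun y => (⟨υ y, fun x => ζ (pt y x.1 x.2), fun x => h1 _ _ _⟩ : PiPt η ξ)
      map_smul' := by
        intro a y
        refine PiPt.ext_iff'.2 ⟨GSetIn.map_smul υ a y, fun x hs ht => ?_⟩
        change ζ (pt (a • y) x hs) = a • ζ (pt y (a⁻¹ • x) _)
        rw [← GSetIn.map_smul]
        congr 1
        refine h.ext ?_ ?_
        · rw [h1, GSetIn.map_smul, GSetIn.map_smul, h1, smul_inv_smul]
        · rw [h2, GSetIn.map_smul, h2] }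
  have hk : Function.Bijective (fun y => k y) := by
    constructor
    · intro y₁ y₂ e
      obtain ⟨e1, e2⟩ := PiPt.ext_iff'.1 e
      refine h.inj _ _ e1 fun x₁ x₂ hx₁ hx₂ hx => ?_
      have hy₁ : η (ξ (ζ x₁)) = υ y₁ := by rw [h.w, hx₁]
      have hy₂ : η (ξ (ζ x₁)) = υ y₂ := by rw [hx, h.w, hx₂]
      have e3 : ζ (pt y₁ (ξ (ζ x₁)) hy₁) = ζ (pt y₂ (ξ (ζ x₁)) hy₂) := e2 _ hy₁ hy₂
      rw [hpt _ _ _ hx₁] at e3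
      rw [e3]
      congr 1
      exact h.ext ((h1 _ _ _).trans hx) ((h2 _ _ _).trans hx₂.symm)
    · intro s
      obtain ⟨y, hy, hs⟩ := h.surj (PiPt.pt s) (fun x hx => PiPt.sec s ⟨x, hx⟩)
        (fun x hx => PiPt.p_sec s ⟨x, hx⟩)
      refine ⟨y, PiPt.ext_iff'.2 ⟨hy, fun x hx hx' => ?_⟩⟩
      exact hs (pt y x hx) x hx' (h2 _ _ _) (h1 _ _ _)
  let eY := isoOfBijective k hk
  have sq' : IsPullback (ζ ≫ ξ) (η' ≫ eY.hom) η (piProj η hη ξ) :=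
    IsPullback.of_iso h.sq (Iso.refl _) (Iso.refl _) eY (Iso.refl _) (by simp) (by simp) (by simp)
      (by rw [Iso.refl_hom, Category.comp_id]; rfl)
  have hf := sq'.isoIsPullback_hom_fst _ _ (fiberProd.isPullback T.mulSys η (piProj η hη ξ))
  have hs := sq'.isoIsPullback_hom_snd _ _ (fiberProd.isPullback T.mulSys η (piProj η hη ξ))
  let eX := sq'.isoIsPullback _ _ (fiberProd.isPullback T.mulSys η (piProj η hη ξ))
  refine ⟨eX, eY, hom_ext fun x => ?_, hs, rfl⟩
  have e1 : (eX.hom x).1.1 = ξ (ζ x) := congr_hom hf x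
  have e2 : (eX.hom x).1.2 = k (η' x) := congr_hom hs x
  change PiPt.sec (eX.hom x).1.2 ⟨(eX.hom x).1.1, (eX.hom x).2⟩ = ζ x
  have e3 := (PiPt.ext_iff'.1 e2).2 (eX.hom x).1.1 (eX.hom x).2 (by rw [e1]; exact h.w x)
  refine e3.trans ?_
  change ζ (pt (η' x) (eX.hom x).1.1 _) = ζ x
  congr 1
  exact h.ext ((h1 _ _ _).trans e1) (h2 _ _ _)

/-! ### Closure properties of exponential diagrams -/

/-- The fibers of the identity are single points, so a section over the fiber at $x$ is just a point
of $Z$ over $x$. -/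
theorem id (p : Z ⟶ X) : IsExp (𝟙 X) p (𝟙 Z) (𝟙 Z) p where
  sq := by rw [Category.id_comp]; exact IsPullback.of_vert_isIso ⟨by simp⟩
  inj y₁ y₂ _ h2 := h2 y₁ y₂ rfl rfl (by assumption)
  surj y σ hσ := ⟨σ y rfl, hσ _ _, fun x' x hx e1 _ => by subst hx; exact e1⟩

/-- The identity of $X$ has exactly one section over each fiber of $\eta$. This diagram computes the
norm of $1$. -/
theorem one (η : X ⟶ Y) : IsExp η (𝟙 X) (𝟙 X) η (𝟙 Y) where
  sq := IsPullback.of_horiz_isIso ⟨by simp⟩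
  inj y₁ y₂ h1 _ := h1
  surj y σ hσ := ⟨y, rfl, fun x' x hx _ e2 => e2.trans (hσ x hx).symm⟩

/-- The fiber of $\theta\eta$ over $w$ is the union of the fibers $\eta^{-1}(y)$ with $\theta(y)=w$.
A section over it is therefore a family of points of $Y'$, one over each such $y$, that is, a
section of $\upsilon$ over $\theta^{-1}(w)$. -/
theorem comp {W P X₂ W' : GSetIn T.C} (h : IsExp η ξ ζ η' υ) {θ : Y ⟶ W} {ζ₂ : X₂ ⟶ Y'}
    {θ' : X₂ ⟶ W'} {υ₂ : W' ⟶ W} (h₂ : IsExp θ υ ζ₂ θ' υ₂) {u : P ⟶ X'} {v : P ⟶ X₂}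
    (sq : IsPullback u v η' ζ₂) : IsExp (η ≫ θ) ξ (u ≫ ζ) (v ≫ θ') υ₂ where
  sq := by rw [Category.assoc]; exact (sq.paste_horiz h.sq).paste_vert h₂.sq
  inj y₁ y₂ hy hx := by
    refine h₂.inj y₁ y₂ hy fun z₁ z₂ hz₁ hz₂ hz => h.inj _ _ hz fun x₁ x₂ hx₁ hx₂ e => ?_
    obtain ⟨p₁, rfl, rfl⟩ := pullback_surj T.mulSys sq hx₁
    obtain ⟨p₂, rfl, rfl⟩ := pullback_surj T.mulSys sq hx₂
    exact hx p₁ p₂ hz₁ hz₂ e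
  surj w σ hσ := by
    -- `τ y` encodes the restriction of `σ` to $\eta^{-1}(y)$; as `y` varies, `τ` is the section of
    -- $\upsilon$ to which `h₂` applies.
    choose τ h1 h2 using fun (y : Y) (hy : θ y = w) =>
      h.surj y (fun x hx => σ x (by rw [comp_app, hx, hy])) (fun x hx => hσ _ _)
    obtain ⟨y', hy', hs⟩ := h₂.surj w τ h1
    refine ⟨y', hy', fun p x hx e1 e2 => ?_⟩
    have hx' : θ (η x) = w := hx
    have e3 : υ (ζ₂ (v p)) = η x := by
      rw [← pullback_w sq p, ← h.w]; exact congrArg η e2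
    exact h2 (η x) hx (u p) x rfl ((pullback_w sq p).trans (hs (v p) (η x) hx e1 e3)) e2

end IsExp

end ExponentialPointwise

/-! ### Further closure properties: composites over $X$, base change, fibered products -/

section ExponentialClosure

open GSetIn hiding map_smul

variable {G : Type u} [Group G] {T : TambaraSystem G}

namespace IsExp

variable {X Y Z X' Y' : GSetIn T.C} {η : X ⟶ Y} {ξ : Z ⟶ X} {ζ : X' ⟶ Z}
  {η' : X' ⟶ Y'} {υ : Y' ⟶ Y}

/-- A section of $\xi b$ over $\eta^{-1}(y)$ induces a section of $\xi$, that is, a point $y'$ of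
$Y'$ over $y$. The remaining datum is a lift of that section along $b$, which is a section of the
pull-back $b'$ over $\eta'^{-1}(y')$. -/
theorem trans {B B' X'' Y'' : GSetIn T.C} (h : IsExp η ξ ζ η' υ) {b : B ⟶ Z} {b' : B' ⟶ X'}
    {z : B' ⟶ B} (sq : IsPullback b' z ζ b) {l : X'' ⟶ B'} {ρ : X'' ⟶ Y''} {υ' : Y'' ⟶ Y'}
    (h₂ : IsExp η' b' l ρ υ') : IsExp η (b ≫ ξ) (l ≫ z) ρ (υ' ≫ υ) where
  sq := by
    have e : (l ≫ z) ≫ b ≫ ξ = (l ≫ b') ≫ ζ ≫ ξ := by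
      simp only [Category.assoc, reassoc_of% sq.w]
    rw [e]
    exact h₂.sq.paste_horiz h.sq
  inj y₁ y₂ hy hx := by
    have key : ∀ x₁ x₂ : X'', ρ x₁ = y₁ → ρ x₂ = y₂ → ξ (ζ (b' (l x₁))) = ξ (ζ (b' (l x₂))) →
        z (l x₁) = z (l x₂) := by
      intro x₁ x₂ e1 e2 e
      rw [pullback_w sq, pullback_w sq] at e
      exact hx x₁ x₂ e1 e2 e
    have hυ : υ' y₁ = υ' y₂ := by
      refine h.inj _ _ hy fun x₁ x₂ e1 e2 e => ?_
      obtain ⟨p₁, rfl, hp₁⟩ := h₂.exists_point e1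
      obtain ⟨p₂, rfl, hp₂⟩ := h₂.exists_point e2
      rw [pullback_w sq, pullback_w sq, key p₁ p₂ hp₁ hp₂ e]
    refine h₂.inj _ _ hυ fun x₁ x₂ e1 e2 e => pullback_inj T.mulSys sq e ?_
    exact key x₁ x₂ e1 e2 (by rw [e])
  surj y σ hσ := by
    obtain ⟨y', hy', hs⟩ := h.surj y (fun x hx => b (σ x hx)) hσ
    have hw : ∀ x' : X', η' x' = y' → η (ξ (ζ x')) = y := fun x' e => by rw [h.w, e, hy']
    -- `τ x'` is the point of $B'$ given by `x'` and the value of `σ` at $\xi(\zeta(x'))$; these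
    -- agree in $Z$ because $y'$ encodes $b\sigma$.
    choose τ h1 h2 using fun (x' : X') (hx : η' x' = y') =>
      pullback_surj T.mulSys sq (hs x' _ (hw x' hx) hx rfl)
    obtain ⟨y'', hy'', hs'⟩ := h₂.surj y' τ h1
    refine ⟨y'', (congrArg υ hy'').trans hy', fun x'' x hx e1 e2 => ?_⟩
    have e3 : η' (b' (l x'')) = y' := by rw [h₂.w, e1, hy'']
    have e4 : ξ (ζ (b' (l x''))) = x := by rw [pullback_w sq]; exact e2
    subst e4
    exact (congrArg (fun t : B' => z t) (hs' x'' _ e3 e1 rfl)).trans (h2 _ e3)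

/-- The fiber of $\eta_1$ over $v$ is identified by $f'$ with the fiber of $\eta$ over $f(v)$, and
the sections over these fibers correspond because $Z_1$ is the pull-back of $Z$. -/
theorem baseChange {V X₁ Z₁ X₁' Y₁' : GSetIn T.C} (h : IsExp η ξ ζ η' υ) {f : V ⟶ Y}
    {η₁ : X₁ ⟶ V} {f' : X₁ ⟶ X} (sqX : IsPullback η₁ f' f η) {ξ₁ : Z₁ ⟶ X₁} {fZ : Z₁ ⟶ Z}
    (sqZ : IsPullback ξ₁ fZ f' ξ) {υ₁ : Y₁' ⟶ V} {fY : Y₁' ⟶ Y'} (sqY : IsPullback υ₁ fY f υ)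
    {ρ₁ : X₁' ⟶ Y₁'} {fX' : X₁' ⟶ X'} (sqX' : IsPullback ρ₁ fX' fY η') {ζ₁ : X₁' ⟶ Z₁}
    (h1 : ζ₁ ≫ fZ = fX' ≫ ζ) (h2 : ζ₁ ≫ ξ₁ ≫ η₁ = ρ₁ ≫ υ₁) : IsExp η₁ ξ₁ ζ₁ ρ₁ υ₁ := by
  have h1' : ∀ p, fZ (ζ₁ p) = ζ (fX' p) := congr_hom h1
  have h2' : ∀ p, η₁ (ξ₁ (ζ₁ p)) = υ₁ (ρ₁ p) := congr_hom h2
  have h3 : ∀ p, f' (ξ₁ (ζ₁ p)) = ξ (ζ (fX' p)) := fun p => by rw [pullback_w sqZ, h1']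
  refine ⟨isPullback_of_forall T.mulSys h2' (fun p q e1 e2 => ?_) (fun x y e => ?_),
    fun y₁ y₂ hy hx => ?_, fun y σ hσ => ?_⟩
  · refine pullback_inj T.mulSys sqX' e2 (h.ext ?_ ?_)
    · rw [← h3, ← h3]; exact congrArg f' e1
    · rw [← pullback_w sqX', ← pullback_w sqX', e2]
  · obtain ⟨x', e1, e2⟩ := h.exists_point (x := f' x) (y := fY y)
      (by rw [← pullback_w sqX, e, pullback_w sqY])
    obtain ⟨p, rfl, rfl⟩ := pullback_surj T.mulSys sqX' e2.symm
    exact ⟨p, pullback_inj T.mulSys sqX ((h2' p).trans e.symm) ((h3 p).trans e1), rfl⟩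
  · refine pullback_inj T.mulSys sqY hy (h.inj _ _ ?_ fun x₁ x₂ e1 e2 e => ?_)
    · rw [← pullback_w sqY, ← pullback_w sqY, hy]
    · obtain ⟨p₁, rfl, rfl⟩ := pullback_surj T.mulSys sqX' e1.symm
      obtain ⟨p₂, rfl, rfl⟩ := pullback_surj T.mulSys sqX' e2.symm
      rw [← h1', ← h1', hx p₁ p₂ rfl rfl]
      refine pullback_inj T.mulSys sqX ?_ ?_
      · rw [h2', h2', hy]
      · rw [h3, h3, e]
  -- `τ` inverts the bijection $\eta_1^{-1}(y)\to\eta^{-1}(f(y))$ given by `f'`; it carries the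
  -- section `σ` over to a section of `ξ`.
  · choose τ t1 t2 using fun (x : X) (hx : η x = f y) => pullback_surj T.mulSys sqX hx.symm
    obtain ⟨y', hy', hs⟩ := h.surj (f y) (fun x hx => fZ (σ (τ x hx) (t1 x hx))) fun x hx => by
      rw [← pullback_w sqZ, hσ, t2]
    obtain ⟨y₁, rfl, rfl⟩ := pullback_surj T.mulSys sqY hy'.symm
    refine ⟨y₁, rfl, fun p x hx e1 e2 => pullback_inj T.mulSys sqZ (e2.trans (hσ _ _).symm) ?_⟩
    have e3 : η (f' x) = f (υ₁ y₁) := by rw [← pullback_w sqX, hx]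
    have e4 : τ (f' x) e3 = x := pullback_inj T.mulSys sqX ((t1 _ _).trans hx.symm) (t2 _ _)
    rw [h1', hs (fX' p) (f' x) e3 (by rw [← pullback_w sqX', e1]) (by rw [← h3, e2])]
    simp only [e4]

/-- A section of a fibered product over $X$ is a pair of sections of the two factors, so the new
base is $Y_1\times_Y Y_2$. -/
theorem prod {Z₁ X₁ Y₁ Z₂ X₂ Y₂ P X' Y' : GSetIn T.C} {ξ₁ : Z₁ ⟶ X} {ζ₁ : X₁ ⟶ Z₁}
    {η₁ : X₁ ⟶ Y₁} {υ₁ : Y₁ ⟶ Y} (h₁ : IsExp η ξ₁ ζ₁ η₁ υ₁) {ξ₂ : Z₂ ⟶ X} {ζ₂ : X₂ ⟶ Z₂}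
    {η₂ : X₂ ⟶ Y₂} {υ₂ : Y₂ ⟶ Y} (h₂ : IsExp η ξ₂ ζ₂ η₂ υ₂) {a : P ⟶ Z₁} {b : P ⟶ Z₂}
    (sqZ : IsPullback a b ξ₁ ξ₂) {c : Y' ⟶ Y₁} {d : Y' ⟶ Y₂} (sqY : IsPullback c d υ₁ υ₂)
    {ρ : X' ⟶ Y'} {c' : X' ⟶ X₁} (sq₁ : IsPullback ρ c' c η₁) {d' : X' ⟶ X₂}
    (sq₂ : IsPullback ρ d' d η₂) {ζ : X' ⟶ P} (ha : ζ ≫ a = c' ≫ ζ₁) (hb : ζ ≫ b = d' ≫ ζ₂) :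
    IsExp η (a ≫ ξ₁) ζ ρ (c ≫ υ₁) := by
  have ha' : ∀ p, a (ζ p) = ζ₁ (c' p) := congr_hom ha
  have hb' : ∀ p, b (ζ p) = ζ₂ (d' p) := congr_hom hb
  have hab : ∀ p, ξ₁ (ζ₁ (c' p)) = ξ₂ (ζ₂ (d' p)) := fun p => by
    rw [← ha', pullback_w sqZ, hb']
  refine ⟨?_, fun y₁ y₂ hy hx => ?_, fun y σ hσ => ?_⟩
  · rw [← Category.assoc, ha, Category.assoc]
    exact sq₁.flip.paste_horiz h₁.sq
  · have hy2 : υ₂ (d y₁) = υ₂ (d y₂) := by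
      rw [← pullback_w sqY, ← pullback_w sqY]; exact hy
    have key : ∀ p₁ p₂ : X', ρ p₁ = y₁ → ρ p₂ = y₂ →
        ξ₁ (ζ₁ (c' p₁)) = ξ₁ (ζ₁ (c' p₂)) → ζ p₁ = ζ p₂ := fun p₁ p₂ e1 e2 e =>
      hx p₁ p₂ e1 e2 (by rw [comp_app, comp_app, ha', ha', e])
    refine pullback_inj T.mulSys sqY (h₁.inj _ _ hy fun x₁ x₂ e1 e2 e => ?_)
      (h₂.inj _ _ hy2 fun x₁ x₂ e1 e2 e => ?_)
    · obtain ⟨p₁, rfl, rfl⟩ := pullback_surj T.mulSys sq₁ e1.symm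
      obtain ⟨p₂, rfl, rfl⟩ := pullback_surj T.mulSys sq₁ e2.symm
      rw [← ha', ← ha', key p₁ p₂ rfl rfl e]
    · obtain ⟨p₁, rfl, rfl⟩ := pullback_surj T.mulSys sq₂ e1.symm
      obtain ⟨p₂, rfl, rfl⟩ := pullback_surj T.mulSys sq₂ e2.symm
      rw [← hab, ← hab] at e
      rw [← hb', ← hb', key p₁ p₂ rfl rfl e]
  · obtain ⟨y₁, hy₁, hs₁⟩ := h₁.surj y (fun x hx => a (σ x hx)) hσ
    obtain ⟨y₂, hy₂, hs₂⟩ := h₂.surj y (fun x hx => b (σ x hx)) fun x hx => by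
      rw [← pullback_w sqZ]; exact hσ x hx
    obtain ⟨y', rfl, rfl⟩ := pullback_surj T.mulSys sqY (hy₁.trans hy₂.symm)
    refine ⟨y', hy₁, fun p x hx e1 e2 => ?_⟩
    have e3 : ξ₁ (ζ₁ (c' p)) = x := by rw [← ha']; exact e2
    refine pullback_inj T.mulSys sqZ ?_ ?_
    · rw [ha']; exact hs₁ _ x hx (by rw [← pullback_w sq₁, e1]) e3
    · rw [hb']; exact hs₂ _ x hx (by rw [← pullback_w sq₂, e1]) ((hab p).symm.trans e3)

end IsExp

end ExponentialClosure

/-! ### The semiring of isomorphism classes -/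

section Classes

open GSetIn hiding map_smul

variable {G : Type u} [Group G] {T : TambaraSystem G} {M : SemiMackeyFunctor.{u, w} T.mulSys}

theorem coprod.bijective_desc {C : Set (Subgroup G)} {A B D : GSetIn C} {i : A ⟶ D} {j : B ⟶ D}
    (hi : ∀ x y : A, i x = i y → x = y) (hj : ∀ x y : B, j x = j y → x = y)
    (hij : ∀ (x : A) (y : B), i x ≠ j y) (hd : ∀ d : D, (∃ x, i x = d) ∨ ∃ y, j y = d) :
    Function.Bijective (fun s : coprod A B => coprod.desc i j s) := by
  constructor
  · rintro (x | x) (y | y) e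
    · exact congrArg Sum.inl (hi x y e)
    · exact (hij x y e).elim
    · exact (hij y x e.symm).elim
    · exact congrArg Sum.inr (hj x y e)
  · intro d
    rcases hd d with ⟨x, hx⟩ | ⟨y, hy⟩
    · exact ⟨Sum.inl x, hx⟩
    · exact ⟨Sum.inr y, hy⟩

theorem coprod.hom_ext {C : Set (Subgroup G)} {A B D : GSetIn C} {f g : coprod A B ⟶ D}
    (h1 : coprod.inl A B ≫ f = coprod.inl A B ≫ g) (h2 : coprod.inr A B ≫ f = coprod.inr A B ≫ g) :
    f = g :=
  GSetIn.hom_ext (by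
    rintro (x | x)
    · exact congr_hom h1 x
    · exact congr_hom h2 x)

/-- The empty `G`-set. -/
def emptyObj (C : Set (Subgroup G)) : GSetIn C where
  carrier := PEmpty
  action :=
    { smul := fun _ x => x
      one_smul := fun x => x.elim
      mul_smul := fun _ _ x => x.elim }
  stab_mem x := x.elim

/-- The map out of the empty `G`-set. -/
def emptyObj.desc {C : Set (Subgroup G)} (X : GSetIn C) : emptyObj C ⟶ X where
  toFun x := x.elim
  map_smul' _ x := x.elim

/-- The empty $G$-set is the disjoint union of the empty family, so additivity identifies
$M(\emptyset)$ with the empty product, a single point. -/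
theorem SemiMackeyFunctor.eq_of_isEmpty {C : Set (Subgroup G)} {O : Subgroup G → Set (Subgroup G)}
    {h : IsMackeySystem C O} (M : SemiMackeyFunctor.{u, w} h) {X : GSetIn C} [IsEmpty X]
    (m m' : M.obj X) : m = m' := by
  have hb : Function.Bijective (fun s : sigmaObj (fun l : PEmpty.{u + 1} => X) =>
      sigmaObj.desc (fun l => l.elim : ∀ l : PEmpty.{u + 1}, X ⟶ X) s) :=
    ⟨fun s => s.1.elim, fun x => isEmptyElim x⟩
  exact (M.sigma_bijective hb).1 (funext fun l => l.elim)

theorem SemiMackeyFunctor.res_res {X Y Z : GSetIn T.C} {f : X ⟶ Y} {g : Y ⟶ Z} {k : X ⟶ Z}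
    (w : f ≫ g = k) (m : M.obj Z) : M.res f (M.res g m) = M.res k m := by
  rw [← w, M.res_comp_apply]

theorem SemiMackeyFunctor.res_mul_res {X Y Z Z' : GSetIn T.C} {u : X ⟶ Y} {f : Y ⟶ Z} {g : Y ⟶ Z'}
    {f' : X ⟶ Z} {g' : X ⟶ Z'} (hf : u ≫ f = f') (hg : u ≫ g = g') (m : M.obj Z)
    (n : M.obj Z') : M.res u (M.res f m * M.res g n) = M.res f' m * M.res g' n := by
  rw [map_mul, M.res_res hf, M.res_res hg]

namespace SM

variable {X Y : GSetIn T.C}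

theorem ind {P : SM M X → Prop} (h : ∀ a, P (mk a)) (s : SM M X) : P s := Quotient.ind h s

/-- A bijective morphism is invertible; its inverse respects the elements of $M$ by functoriality of
$M^*$. Nearly all equalities of classes below reduce to this criterion. -/
theorem mk_eq {a b : MObj M X} (f : a.A ⟶ b.A) (hf : Function.Bijective (fun x : a.A => f x))
    (w : f ≫ b.p = a.p) (hm : M.res f b.m = a.m) : mk a = mk b := by
  let e := isoOfBijective f hf
  have he : e.hom = f := rfl
  refine Quotient.sound ⟨⟨⟨f, w, hm⟩, ⟨e.inv, ?_, ?_⟩, ?_, ?_⟩⟩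
  · rw [← w, ← he, e.inv_hom_id_assoc]
  · rw [← hm, ← he, ← M.res_comp_apply, e.inv_hom_id, M.res_id_apply]
  · exact MHom.ext e.hom_inv_id
  · exact MHom.ext e.inv_hom_id

theorem exists_iso {a b : MObj M X} (h : mk a = mk b) :
    ∃ e : a.A ≅ b.A, e.hom ≫ b.p = a.p ∧ M.res e.hom b.m = a.m := by
  obtain ⟨e⟩ := Quotient.exact h
  exact ⟨⟨e.hom.f, e.inv.f, congrArg MHom.f e.hom_inv_id, congrArg MHom.f e.inv_hom_id⟩,
    e.hom.w, e.hom.res_m⟩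

/-! ### Sums -/

/-- Any model of the disjoint union computes the sum, since an element of $M(A\amalg B)$ is
determined by its two restrictions. -/
theorem mk_sum_eq {a b c : MObj M X} (i : a.A ⟶ c.A) (j : b.A ⟶ c.A)
    (hij : Function.Bijective (fun s : coprod a.A b.A => coprod.desc i j s))
    (hi : i ≫ c.p = a.p) (hj : j ≫ c.p = b.p) (hmi : M.res i c.m = a.m)
    (hmj : M.res j c.m = b.m) : mk (a.sum b) = mk c :=
  mk_eq (a := a.sum b) (coprod.desc i j) hij (coprod.hom_ext hi hj)
    ((M.existsUnique_coprod a.m b.m).unique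
      ⟨(M.res_res rfl _).trans hmi, (M.res_res rfl _).trans hmj⟩
      (M.glue_spec a.m b.m))

theorem mk_sum_congr {a b a' b' : MObj M X} (ha : mk a = mk a') (hb : mk b = mk b') :
    mk (a.sum b) = mk (a'.sum b') := by
  obtain ⟨e, h1, h2⟩ := exists_iso ha
  obtain ⟨e', h1', h2'⟩ := exists_iso hb
  refine mk_sum_eq (e.hom ≫ coprod.inl _ _) (e'.hom ≫ coprod.inr _ _)
    (coprod.bijective_desc ?_ ?_ ?_ ?_) h1 h1' ?_ ?_
  · exact fun x y h => iso_inj e (Sum.inl_injective h)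
  · exact fun x y h => iso_inj e' (Sum.inr_injective h)
  · exact fun x y h => Sum.inl_ne_inr h
  · rintro (d | d)
    · exact Or.inl ⟨e.inv d, congrArg Sum.inl (inv_hom_app e d)⟩
    · exact Or.inr ⟨e'.inv d, congrArg Sum.inr (inv_hom_app e' d)⟩
  · exact (M.res_res rfl _).symm.trans ((congrArg _ (M.res_inl_glue a'.m b'.m)).trans h2)
  · exact (M.res_res rfl _).symm.trans ((congrArg _ (M.res_inr_glue a'.m b'.m)).trans h2')

noncomputable scoped instance : Add (SM M X) :=
  ⟨Quotient.map₂ MObj.sum fun _ _ h _ _ h' =>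
    Quotient.exact (mk_sum_congr (Quotient.sound h) (Quotient.sound h'))⟩

theorem mk_add (a b : MObj M X) : mk a + mk b = mk (a.sum b) := rfl

-- The element `1` is no real choice: $M(\emptyset)$ has only one element.
scoped instance : Zero (SM M X) :=
  ⟨mk ⟨emptyObj T.C, emptyObj.desc X, isOHom_finO _ fun _ =>
    Set.Finite.subset Set.finite_empty fun x _ => PEmpty.elim x, 1⟩⟩

theorem mk_eq_zero (a : MObj M X) [IsEmpty a.A] : mk a = 0 :=
  have : IsEmpty (emptyObj T.C) := inferInstanceAs (IsEmpty PEmpty)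
  (mk_eq (b := a) (emptyObj.desc a.A) ⟨fun x => PEmpty.elim x, fun x => isEmptyElim x⟩
    (GSetIn.hom_ext fun x => PEmpty.elim x) (M.eq_of_isEmpty _ _)).symm

protected theorem zero_add (s : SM M X) : 0 + s = s := by
  induction s using SM.ind with | _ a
  refine mk_sum_eq (emptyObj.desc a.A) (𝟙 a.A) (coprod.bijective_desc ?_ ?_ ?_ ?_) ?_
    (Category.id_comp _) ?_ (M.res_id_apply _)
  · exact fun x => PEmpty.elim x
  · exact fun x y h => h
  · exact fun x => PEmpty.elim x
  · exact fun d => Or.inr ⟨d, rfl⟩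
  · exact GSetIn.hom_ext fun x => PEmpty.elim x
  · have : IsEmpty (emptyObj T.C) := inferInstanceAs (IsEmpty PEmpty)
    exact M.eq_of_isEmpty _ _

protected theorem add_comm (s t : SM M X) : s + t = t + s := by
  induction s using SM.ind with | _ a
  induction t using SM.ind with | _ b
  refine mk_sum_eq (c := b.sum a) (coprod.inr _ _) (coprod.inl _ _)
    (coprod.bijective_desc ?_ ?_ ?_ ?_) rfl rfl (M.res_inr_glue _ _) (M.res_inl_glue _ _)
  · exact fun x y h => Sum.inr_injective h
  · exact fun x y h => Sum.inl_injective h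
  · exact fun x y h => Sum.inr_ne_inl h
  · rintro (d | d)
    · exact Or.inr ⟨d, rfl⟩
    · exact Or.inl ⟨d, rfl⟩

protected theorem add_assoc (s t r : SM M X) : s + t + r = s + (t + r) := by
  induction s using SM.ind with | _ a
  induction t using SM.ind with | _ b
  induction r using SM.ind with | _ c
  refine mk_sum_eq (a := a.sum b) (b := c) (c := a.sum (b.sum c))
    (coprod.desc (coprod.inl _ _) (coprod.inl _ _ ≫ coprod.inr _ _))
    (coprod.inr b.A c.A ≫ coprod.inr _ _)
    (coprod.bijective_desc ?_ ?_ ?_ ?_) (coprod.hom_ext rfl rfl) rfl ?_ ?_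
  · rintro (x | x) (y | y) h
    · exact congrArg Sum.inl (Sum.inl_injective h)
    · exact (Sum.inl_ne_inr h).elim
    · exact (Sum.inr_ne_inl h).elim
    · exact congrArg Sum.inr (Sum.inl_injective (Sum.inr_injective h))
  · exact fun x y h => Sum.inr_injective (Sum.inr_injective h)
  · rintro (x | x) y h
    · exact Sum.inl_ne_inr h
    · exact Sum.inl_ne_inr (Sum.inr_injective h)
  · rintro (d | d | d)
    · exact Or.inl ⟨Sum.inl d, rfl⟩
    · exact Or.inl ⟨Sum.inr d, rfl⟩
    · exact Or.inr ⟨d, rfl⟩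
  · refine (M.existsUnique_coprod a.m b.m).unique ⟨?_, ?_⟩ (M.glue_spec a.m b.m)
    · exact (M.res_res rfl _).trans (M.res_inl_glue a.m (M.glue b.m c.m))
    · refine (M.res_res rfl _).trans
        ((M.res_comp_apply (coprod.inl b.A c.A) (coprod.inr a.A _) _).trans ?_)
      exact (congrArg _ (M.res_inr_glue a.m (M.glue b.m c.m))).trans (M.res_inl_glue _ _)
  · refine (M.res_comp_apply (coprod.inr b.A c.A) (coprod.inr a.A _) _).trans ?_
    exact (congrArg _ (M.res_inr_glue a.m (M.glue b.m c.m))).trans (M.res_inr_glue _ _)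

/-! ### Products -/

/-- Any pull-back of the two structure maps computes the product, through its isomorphism with the
explicit fibered product. -/
theorem mk_prod_eq {a b c : MObj M X} (u : c.A ⟶ a.A) (v : c.A ⟶ b.A)
    (sq : IsPullback u v a.p b.p) (hp : u ≫ a.p = c.p) (hm : M.res u a.m * M.res v b.m = c.m) :
    mk c = mk (a.prod b) := by
  let e := sq.isoIsPullback _ _ (fiberProd.isPullback T.mulSys a.p b.p)
  have h1 : e.hom ≫ fiberProd.fst T.mulSys a.p b.p = u := sq.isoIsPullback_hom_fst _ _ _
  have h2 : e.hom ≫ fiberProd.snd T.mulSys a.p b.p = v := sq.isoIsPullback_hom_snd _ _ _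
  refine mk_eq (b := a.prod b) e.hom (iso_bijective e) ?_ ?_
  · exact (Category.assoc _ _ _).symm.trans ((congrArg (· ≫ a.p) h1).trans hp)
  · rw [← hm, ← h1, ← h2, M.res_comp_apply, M.res_comp_apply, ← map_mul]
    rfl

theorem mk_prod_congr {a b a' b' : MObj M X} (ha : mk a = mk a') (hb : mk b = mk b') :
    mk (a.prod b) = mk (a'.prod b') := by
  obtain ⟨e, h1, h2⟩ := exists_iso ha
  obtain ⟨e', h1', h2'⟩ := exists_iso hb
  refine mk_prod_eq (c := a.prod b) (fiberProd.fst T.mulSys _ _ ≫ e.hom)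
    (fiberProd.snd T.mulSys _ _ ≫ e'.hom)
    ?_ ?_ ?_
  · exact IsPullback.of_iso (fiberProd.isPullback T.mulSys a.p b.p) (Iso.refl _) e e' (Iso.refl _)
      rfl rfl (by simp [h1]) (by simp [h1'])
  · exact (Category.assoc _ _ _).trans (congrArg (fiberProd.fst T.mulSys a.p b.p ≫ ·) h1)
  · exact congrArg₂ (· * ·) ((M.res_comp_apply _ _ _).trans (congrArg _ h2))
      ((M.res_comp_apply _ _ _).trans (congrArg _ h2'))

scoped instance : Mul (SM M X) :=
  ⟨Quotient.map₂ MObj.prod fun _ _ h _ _ h' =>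
    Quotient.exact (mk_prod_congr (Quotient.sound h) (Quotient.sound h'))⟩

theorem mk_mul (a b : MObj M X) : mk a * mk b = mk (a.prod b) := rfl

/-- The object `(X = X, 1)`. -/
def oneObj (X : GSetIn T.C) : MObj M X := ⟨X, 𝟙 X, isOHom_finO_id X, 1⟩

scoped instance : One (SM M X) := ⟨mk (oneObj X)⟩

protected theorem one_mul (s : SM M X) : 1 * s = s := by
  induction s using SM.ind with | _ a
  refine (mk_prod_eq (a := oneObj X) (c := a) a.p (𝟙 _) (?_ : IsPullback a.p (𝟙 _) (𝟙 X) a.p) (Category.comp_id _) ?_).symm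
  · exact IsPullback.of_vert_isIso ⟨by simp⟩
  · rw [M.res_id_apply]
    exact (congrArg (· * a.m) (map_one (M.res a.p))).trans (one_mul _)

protected theorem mul_comm (s t : SM M X) : s * t = t * s := by
  induction s using SM.ind with | _ a
  induction t using SM.ind with | _ b
  exact mk_prod_eq (c := a.prod b) (fiberProd.snd _ _ _) (fiberProd.fst _ _ _)
    (fiberProd.isPullback T.mulSys a.p b.p).flip (fiberProd.isPullback T.mulSys a.p b.p).w.symm
    (mul_comm _ _)

protected theorem mul_assoc (s t r : SM M X) : s * t * r = s * (t * r) := by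
  induction s using SM.ind with | _ a
  induction t using SM.ind with | _ b
  induction r using SM.ind with | _ c
  let v : ((a.prod b).prod c).A ⟶ (b.prod c).A :=
    { toFun := fun q => ⟨(q.1.1.1.2, q.1.2), q.1.1.2.symm.trans q.2⟩
      map_smul' := fun _ _ => rfl }
  refine mk_prod_eq (c := (a.prod b).prod c) (b := b.prod c)
    (fiberProd.fst T.mulSys (a.prod b).p c.p ≫ fiberProd.fst T.mulSys a.p b.p) v
    (isPullback_of_forall T.mulSys ?_ ?_ ?_) rfl ?_
  · exact fun q => q.1.1.2
  · rintro ⟨⟨⟨⟨x, y⟩, h⟩, z⟩, h'⟩ ⟨⟨⟨⟨x₁, y₁⟩, h₁⟩, z₁⟩, h₁'⟩ e1 e2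
    obtain rfl : x = x₁ := e1
    obtain ⟨rfl, rfl⟩ := Prod.ext_iff.1 (Subtype.ext_iff.1 e2)
    rfl
  · rintro x ⟨⟨y, z⟩, h⟩ e
    exact ⟨⟨(⟨(x, y), e⟩, z), e.trans h⟩, rfl, rfl⟩
  · refine (congrArg _ (M.res_mul_res (u := v) rfl rfl b.m c.m)).trans ?_
    refine (mul_assoc _ _ _).symm.trans (congrArg (· * _) ?_)
    exact (M.res_mul_res (u := fiberProd.fst T.mulSys (a.prod b).p c.p)
      (f := fiberProd.fst T.mulSys a.p b.p) (g := fiberProd.snd T.mulSys a.p b.p)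
      rfl rfl a.m b.m).symm

protected theorem zero_mul (s : SM M X) : 0 * s = 0 := by
  induction s using SM.ind with | _ a
  exact @mk_eq_zero _ _ _ _ _ (MObj.prod _ a) ⟨fun q => PEmpty.elim q.1.1⟩

/-- Fibered products distribute over disjoint unions; the elements of $M$ are compared by
restricting to the two summands. -/
protected theorem left_distrib (s t r : SM M X) : s * (t + r) = s * t + s * r := by
  induction s using SM.ind with | _ a
  induction t using SM.ind with | _ b
  induction r using SM.ind with | _ c
  let i : (a.prod b).A ⟶ (a.prod (b.sum c)).A :=
    { toFun := fun q => ⟨(q.1.1, Sum.inl q.1.2), q.2⟩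
      map_smul' := fun _ _ => rfl }
  let j : (a.prod c).A ⟶ (a.prod (b.sum c)).A :=
    { toFun := fun q => ⟨(q.1.1, Sum.inr q.1.2), q.2⟩
      map_smul' := fun _ _ => rfl }
  refine (mk_sum_eq (a := a.prod b) (b := a.prod c) (c := a.prod (b.sum c)) i j
    (coprod.bijective_desc ?_ ?_ ?_ ?_) rfl rfl ?_ ?_).symm
  · intro q q' h
    obtain ⟨h1, h2⟩ := Prod.ext_iff.1 (Subtype.ext_iff.1 h)
    exact Subtype.ext (Prod.ext h1 (Sum.inl_injective h2))
  · intro q q' h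
    obtain ⟨h1, h2⟩ := Prod.ext_iff.1 (Subtype.ext_iff.1 h)
    exact Subtype.ext (Prod.ext h1 (Sum.inr_injective h2))
  · intro q q' h
    exact Sum.inl_ne_inr (Prod.ext_iff.1 (Subtype.ext_iff.1 h)).2
  · rintro ⟨⟨x, y | y⟩, h⟩
    · exact Or.inl ⟨⟨(x, y), h⟩, rfl⟩
    · exact Or.inr ⟨⟨(x, y), h⟩, rfl⟩
  · refine (M.res_mul_res (u := i) (f := fiberProd.fst T.mulSys a.p (b.sum c).p)
      (g := fiberProd.snd T.mulSys a.p (b.sum c).p) rfl rfl a.m (b.sum c).m).trans ?_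
    refine congrArg (_ * ·) ((M.res_res (f := fiberProd.snd T.mulSys a.p b.p)
      (g := coprod.inl b.A c.A) rfl (M.glue b.m c.m)).symm.trans ?_)
    exact congrArg _ (M.res_inl_glue b.m c.m)
  · refine (M.res_mul_res (u := j) (f := fiberProd.fst T.mulSys a.p (b.sum c).p)
      (g := fiberProd.snd T.mulSys a.p (b.sum c).p) rfl rfl a.m (b.sum c).m).trans ?_
    refine congrArg (_ * ·) ((M.res_res (f := fiberProd.snd T.mulSys a.p c.p)
      (g := coprod.inr b.A c.A) rfl (M.glue b.m c.m)).symm.trans ?_)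
    exact congrArg _ (M.res_inr_glue b.m c.m)

noncomputable scoped instance commSemiring : CommSemiring (SM M X) where
  add_assoc := SM.add_assoc
  zero_add := SM.zero_add
  add_zero s := (SM.add_comm s 0).trans (SM.zero_add s)
  add_comm := SM.add_comm
  mul_assoc := SM.mul_assoc
  one_mul := SM.one_mul
  mul_one s := (SM.mul_comm s 1).trans (SM.one_mul s)
  mul_comm := SM.mul_comm
  zero_mul := SM.zero_mul
  mul_zero s := (SM.mul_comm s 0).trans (SM.zero_mul s)
  left_distrib := SM.left_distrib
  right_distrib s t r := by
    rw [SM.mul_comm, SM.left_distrib, SM.mul_comm r s, SM.mul_comm r t]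
  nsmul := nsmulRec

end SM

end Classes

/-! ### Restrictions, transfers and norms on isomorphism classes -/

section StructureMaps

open GSetIn hiding map_smul

variable {G : Type u} [Group G] {T : TambaraSystem G} {M : SemiMackeyFunctor.{u, w} T.mulSys}

/-- Both diagrams are isomorphic to the canonical one on $\Pi_\eta(Z)$. -/
theorem IsExp.exists_iso {X Y Z X₁ Y₁ X₂ Y₂ : GSetIn T.C} {η : X ⟶ Y} {ξ : Z ⟶ X} {ζ₁ : X₁ ⟶ Z}
    {η₁ : X₁ ⟶ Y₁} {υ₁ : Y₁ ⟶ Y} {ζ₂ : X₂ ⟶ Z} {η₂ : X₂ ⟶ Y₂} {υ₂ : Y₂ ⟶ Y}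
    (h₁ : IsExp η ξ ζ₁ η₁ υ₁) (h₂ : IsExp η ξ ζ₂ η₂ υ₂) (hη : IsOHom T.O η) :
    ∃ (eX : X₁ ≅ X₂) (eY : Y₁ ≅ Y₂), eX.hom ≫ ζ₂ = ζ₁ ∧ eX.hom ≫ η₂ = η₁ ≫ eY.hom ∧
      eY.hom ≫ υ₂ = υ₁ := by
  obtain ⟨eX₁, eY₁, a1, b1, c1⟩ := h₁.exists_iso_pi hη
  obtain ⟨eX₂, eY₂, a2, b2, c2⟩ := h₂.exists_iso_pi hη
  refine ⟨eX₁ ≪≫ eX₂.symm, eY₁ ≪≫ eY₂.symm, ?_, ?_, ?_⟩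
  · simp only [Iso.trans_hom, Iso.symm_hom, Category.assoc, ← a1, ← a2, Iso.inv_hom_id_assoc]
  · rw [← cancel_mono eY₂.hom]
    simp only [Iso.trans_hom, Iso.symm_hom, Category.assoc, ← b2, Iso.inv_hom_id_assoc,
      Iso.inv_hom_id, Category.comp_id, b1]
  · simp only [Iso.trans_hom, Iso.symm_hom, Category.assoc, ← c1, ← c2, Iso.inv_hom_id_assoc]

theorem IsExp.comp_iso {X Y Z X' Y' Z₁ : GSetIn T.C} {η : X ⟶ Y} {ξ : Z ⟶ X} {ζ : X' ⟶ Z}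
    {η' : X' ⟶ Y'} {υ : Y' ⟶ Y} (h : IsExp η ξ ζ η' υ) (e : Z ≅ Z₁) {ξ₁ : Z₁ ⟶ X}
    (he : e.hom ≫ ξ₁ = ξ) : IsExp η ξ₁ (ζ ≫ e.hom) η' υ :=
  h.of_iso e.symm (Iso.refl _) (Iso.refl _) (by simp [← he]) (by simp) (by simp) (by simp)

theorem IsExp.isOHom {X Y Z X' Y' : GSetIn T.C} {η : X ⟶ Y} {ξ : Z ⟶ X} {ζ : X' ⟶ Z}
    {η' : X' ⟶ Y'} {υ : Y' ⟶ Y} (h : IsExp η ξ ζ η' υ) (hη : IsOHom T.O η) : IsOHom T.O η' :=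
  hη.of_isPullback T.mulSys h.sq.flip

namespace SM

variable {X Y Z : GSetIn T.C}

/-! ### Restrictions -/

/-- This settles at once that the restriction depends neither on the representative nor on the
pull-back: an isomorphism of representatives turns one pull-back square into a second one on the
same cospan as the other. -/
theorem mk_eq_of_isPullback {ζ : Y ⟶ X} {a a' : MObj M X} (h : mk a = mk a') {c c' : MObj M Y}
    {k : c.A ⟶ a.A} {k' : c'.A ⟶ a'.A} (sq : IsPullback c.p k ζ a.p)
    (sq' : IsPullback c'.p k' ζ a'.p) (hm : M.res k a.m = c.m) (hm' : M.res k' a'.m = c'.m) :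
    mk c = mk c' := by
  obtain ⟨e, h1, h2⟩ := exists_iso h
  have sq'' : IsPullback c.p (k ≫ e.hom) ζ a'.p :=
    IsPullback.of_iso sq (Iso.refl _) (Iso.refl _) e (Iso.refl _) (by simp) (by simp) (by simp)
      (by simp [h1])
  refine mk_eq (sq''.isoIsPullback _ _ sq').hom (iso_bijective _)
    (sq''.isoIsPullback_hom_fst _ _ sq') ?_
  rw [← hm', M.res_res (sq''.isoIsPullback_hom_snd _ _ sq'), M.res_comp_apply, h2, hm]

/-- The restriction along `ζ`, as a map of sets. -/
def resFun (ζ : Y ⟶ X) : SM M X → SM M Y :=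
  Quotient.map (fun a => a.pull (fiberProd.isPullback T.mulSys ζ a.p)) fun a a' h =>
    Quotient.exact (mk_eq_of_isPullback (Quotient.sound h)
      (c := a.pull (fiberProd.isPullback T.mulSys ζ a.p))
      (c' := a'.pull (fiberProd.isPullback T.mulSys ζ a'.p))
      (fiberProd.isPullback T.mulSys ζ a.p) (fiberProd.isPullback T.mulSys ζ a'.p) rfl rfl)

theorem resFun_mk {ζ : Y ⟶ X} {a : MObj M X} {c : MObj M Y} {k : c.A ⟶ a.A}
    (sq : IsPullback c.p k ζ a.p) (hm : M.res k a.m = c.m) : resFun ζ (mk a) = mk c :=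
  mk_eq_of_isPullback (c := a.pull (fiberProd.isPullback T.mulSys ζ a.p)) rfl
    (fiberProd.isPullback T.mulSys ζ a.p) sq rfl hm

theorem exists_pull (ζ : Y ⟶ X) (a : MObj M X) :
    ∃ (c : MObj M Y) (k : c.A ⟶ a.A), IsPullback c.p k ζ a.p ∧ M.res k a.m = c.m :=
  ⟨a.pull (fiberProd.isPullback T.mulSys ζ a.p), fiberProd.snd T.mulSys ζ a.p,
    fiberProd.isPullback T.mulSys ζ a.p, rfl⟩

theorem resFun_zero (ζ : Y ⟶ X) : resFun ζ (0 : SM M X) = 0 :=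
  @mk_eq_zero _ _ _ _ _ (MObj.pull _ (fiberProd.isPullback T.mulSys ζ _))
    ⟨fun q => PEmpty.elim q.1.2⟩

theorem resFun_one (ζ : Y ⟶ X) : resFun ζ (1 : SM M X) = 1 :=
  resFun_mk (a := oneObj X) (c := oneObj Y) (k := ζ)
    (show IsPullback (𝟙 Y) ζ ζ (𝟙 X) from IsPullback.of_horiz_isIso ⟨by simp⟩) (map_one _)

theorem resFun_add (ζ : Y ⟶ X) (s t : SM M X) :
    resFun ζ (s + t) = resFun ζ s + resFun ζ t := by
  induction s using SM.ind with | _ a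
  induction t using SM.ind with | _ b
  obtain ⟨a', k, sqa, hka⟩ := exists_pull ζ a
  obtain ⟨b', l, sqb, hlb⟩ := exists_pull ζ b
  rw [resFun_mk sqa hka, resFun_mk sqb hlb]
  refine resFun_mk (a := a.sum b) (c := a'.sum b')
    (k := coprod.desc (k ≫ coprod.inl a.A b.A) (l ≫ coprod.inr a.A b.A))
    (isPullback_of_forall T.mulSys ?_ ?_ ?_) ?_
  · rintro (x | x)
    · exact pullback_w sqa x
    · exact pullback_w sqb x
  · rintro (x | x) (y | y) e1 e2
    · exact congrArg Sum.inl (pullback_inj T.mulSys sqa e1 (Sum.inl_injective e2))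
    · exact (Sum.inl_ne_inr e2).elim
    · exact (Sum.inr_ne_inl e2).elim
    · exact congrArg Sum.inr (pullback_inj T.mulSys sqb e1 (Sum.inr_injective e2))
  · rintro y (x | x) e
    · obtain ⟨p, h1, h2⟩ := pullback_surj T.mulSys sqa e
      exact ⟨Sum.inl p, h1, congrArg Sum.inl h2⟩
    · obtain ⟨p, h1, h2⟩ := pullback_surj T.mulSys sqb e
      exact ⟨Sum.inr p, h1, congrArg Sum.inr h2⟩
  · refine (M.existsUnique_coprod a'.m b'.m).unique ⟨?_, ?_⟩ (M.glue_spec a'.m b'.m)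
    · refine (M.res_res rfl _).trans ((M.res_comp_apply k (coprod.inl a.A b.A) _).trans ?_)
      exact (congrArg _ (M.res_inl_glue a.m b.m)).trans hka
    · refine (M.res_res rfl _).trans ((M.res_comp_apply l (coprod.inr a.A b.A) _).trans ?_)
      exact (congrArg _ (M.res_inr_glue a.m b.m)).trans hlb

theorem resFun_mul (ζ : Y ⟶ X) (s t : SM M X) :
    resFun ζ (s * t) = resFun ζ s * resFun ζ t := by
  induction s using SM.ind with | _ a
  induction t using SM.ind with | _ b
  obtain ⟨a', k, sqa, hka⟩ := exists_pull ζ a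
  obtain ⟨b', l, sqb, hlb⟩ := exists_pull ζ b
  rw [resFun_mk sqa hka, resFun_mk sqb hlb]
  have sqP := fiberProd.isPullback T.mulSys a.p b.p
  have sqP' := fiberProd.isPullback T.mulSys a'.p b'.p
  -- `f` is the map $A'\times_Y B'\to A\times_X B$ induced by `k` and `l`; it exhibits the source as
  -- the pull-back of the target along `ζ`.
  obtain ⟨f, h1, h2⟩ := sqP.exists_lift (fiberProd.fst T.mulSys a'.p b'.p ≫ k)
    (fiberProd.snd T.mulSys a'.p b'.p ≫ l)
    (by rw [Category.assoc, Category.assoc, ← sqa.w, ← sqb.w, reassoc_of% sqP'.w])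
  have h1' : ∀ q, (f q).1.1 = k q.1.1 := congr_hom h1
  have h2' : ∀ q, (f q).1.2 = l q.1.2 := congr_hom h2
  refine resFun_mk (a := a.prod b) (c := a'.prod b') (k := f)
    (isPullback_of_forall T.mulSys ?_ ?_ ?_) ?_
  · intro q
    exact (pullback_w sqa q.1.1).trans (congrArg (fun x => a.p x) (h1' q)).symm
  · intro q r e1 e2
    have e3 : a'.p q.1.1 = a'.p r.1.1 := e1
    refine Subtype.ext (Prod.ext (pullback_inj T.mulSys sqa e3 ?_)
      (pullback_inj T.mulSys sqb ?_ ?_))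
    · exact (h1' q).symm.trans ((congrArg (fun x => x.1.1) e2).trans (h1' r))
    · rw [← q.2, ← r.2, e3]
    · exact (h2' q).symm.trans ((congrArg (fun x => x.1.2) e2).trans (h2' r))
  · rintro y ⟨⟨x, x'⟩, hx⟩ e
    obtain ⟨p, hp, rfl⟩ := pullback_surj T.mulSys sqa (show ζ y = a.p x from e)
    obtain ⟨p', hp', rfl⟩ := pullback_surj T.mulSys sqb (show ζ y = b.p x' from Eq.trans e hx)
    refine ⟨⟨(p, p'), hp.trans hp'.symm⟩, hp, Subtype.ext (Prod.ext (h1' _) (h2' _))⟩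
  · refine (M.res_mul_res h1 h2 a.m b.m).trans ?_
    exact congrArg₂ (· * ·) ((M.res_comp_apply _ _ _).trans (congrArg _ hka))
      ((M.res_comp_apply _ _ _).trans (congrArg _ hlb))

/-- The restriction along `ζ`. -/
def resHom (ζ : Y ⟶ X) : SM M X →+* SM M Y where
  toFun := resFun ζ
  map_zero' := resFun_zero ζ
  map_one' := resFun_one ζ
  map_add' := resFun_add ζ
  map_mul' := resFun_mul ζ

theorem resFun_id (s : SM M X) : resFun (𝟙 X) s = s := by
  induction s using SM.ind with | _ a
  exact resFun_mk (k := 𝟙 _) (IsPullback.of_vert_isIso ⟨by simp⟩) (M.res_id_apply _)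

theorem resFun_comp (f : X ⟶ Y) (g : Y ⟶ Z) (s : SM M Z) :
    resFun (f ≫ g) s = resFun f (resFun g s) := by
  induction s using SM.ind with | _ a
  obtain ⟨b, k, sq, hk⟩ := exists_pull g a
  obtain ⟨c, l, sq', hl⟩ := exists_pull f b
  rw [resFun_mk sq hk, resFun_mk sq' hl]
  exact resFun_mk (k := l ≫ k) (sq'.flip.paste_horiz sq.flip).flip
    (by rw [M.res_comp_apply, hk, hl])

/-! ### Additive transfers -/

/-- The additive transfer along `ξ`, as a map of sets. -/
def trFun (ξ : X ⟶ Y) (hξ : IsOHom (finO T.C) ξ) : SM M X → SM M Y :=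
  Quotient.map (fun a => a.post ξ hξ) fun a a' h => by
    obtain ⟨e, h1, h2⟩ := exists_iso (Quotient.sound h : mk a = mk a')
    exact Quotient.exact (mk_eq (a := a.post ξ hξ) (b := a'.post ξ hξ) e.hom (iso_bijective e)
      ((Category.assoc _ _ _).symm.trans (congrArg (· ≫ ξ) h1)) h2)

/-- The additive transfer along `ξ`. -/
def trHom (ξ : X ⟶ Y) (hξ : IsOHom (finO T.C) ξ) : SM M X →+ SM M Y where
  toFun := trFun ξ hξ
  map_zero' := @mk_eq_zero _ _ _ _ _ (MObj.post _ ξ hξ) ⟨fun q => PEmpty.elim q⟩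
  map_add' s t := by
    induction s using SM.ind with | _ a
    induction t using SM.ind with | _ b
    refine (mk_sum_eq (a := a.post ξ hξ) (b := b.post ξ hξ) (c := (a.sum b).post ξ hξ)
      (coprod.inl a.A b.A) (coprod.inr a.A b.A) (coprod.bijective_desc ?_ ?_ ?_ ?_) rfl rfl
      (M.res_inl_glue a.m b.m) (M.res_inr_glue a.m b.m)).symm
    · exact fun x y h => Sum.inl_injective h
    · exact fun x y h => Sum.inr_injective h
    · exact fun x y h => Sum.inl_ne_inr h
    · rintro (d | d)
      · exact Or.inl ⟨d, rfl⟩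
      · exact Or.inr ⟨d, rfl⟩

theorem trFun_id (hX : IsOHom (finO T.C) (𝟙 X)) (s : SM M X) : trFun (𝟙 X) hX s = s := by
  induction s using SM.ind with | _ a
  rfl

theorem trFun_comp (f : X ⟶ Y) (g : Y ⟶ Z) (hf : IsOHom (finO T.C) f) (hg : IsOHom (finO T.C) g)
    (hfg : IsOHom (finO T.C) (f ≫ g)) (s : SM M X) :
    trFun (f ≫ g) hfg s = trFun g hg (trFun f hf s) := by
  induction s using SM.ind with | _ a
  rfl

theorem resFun_trFun {X' Y' : GSetIn T.C} {g' : X' ⟶ Y'} {f' : X' ⟶ X} {f : Y' ⟶ Y} {g : X ⟶ Y}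
    (sq : IsPullback g' f' f g) (hg : IsOHom (finO T.C) g) (hg' : IsOHom (finO T.C) g')
    (s : SM M X) : resFun f (trFun g hg s) = trFun g' hg' (resFun f' s) := by
  induction s using SM.ind with | _ a
  obtain ⟨b, k, sq', hk⟩ := exists_pull f' a
  rw [resFun_mk sq' hk]
  exact resFun_mk (a := a.post g hg) (c := b.post g' hg') (k := k) (sq'.paste_horiz sq) hk

/-! ### Multiplicative transfers -/

/-- The norm depends neither on the representative nor on the exponential diagram, by uniqueness of
exponential diagrams up to isomorphism. -/
theorem mk_eq_of_isExp {η : X ⟶ Y} (hη : IsOHom T.O η) {a a' : MObj M X} (h : mk a = mk a')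
    {c c' : MObj M Y} {X₁ X₂ : GSetIn T.C} {l : X₁ ⟶ a.A} {l' : X₂ ⟶ a'.A} {ρ : X₁ ⟶ c.A}
    {ρ' : X₂ ⟶ c'.A} (hρ : IsOHom T.O ρ) (hρ' : IsOHom T.O ρ') (E : IsExp η a.p l ρ c.p)
    (E' : IsExp η a'.p l' ρ' c'.p) (hm : M.tr ρ hρ (M.res l a.m) = c.m)
    (hm' : M.tr ρ' hρ' (M.res l' a'.m) = c'.m) : mk c = mk c' := by
  obtain ⟨e, h1, h2⟩ := exists_iso h
  obtain ⟨eX, eY, e1, e2, e3⟩ := (E.comp_iso e h1).exists_iso E' hη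
  refine mk_eq eY.hom (iso_bijective eY) e3 ?_
  -- The square formed by the isomorphisms `eX` and `eY` is a pull-back, so the Mackey condition
  -- moves $M^*$ of `eY.hom` past $M_*(\rho')$.
  rw [← hm', M.res_tr (IsPullback.of_vert_isIso ⟨e2.symm⟩) hρ' hρ, M.res_res e1,
    M.res_comp_apply, h2, hm]

/-- The multiplicative transfer along `η`, as a map of sets. -/
def normFun (η : X ⟶ Y) (hη : IsOHom T.O η) : SM M X → SM M Y :=
  Quotient.map (fun a => a.expo (isExponential_pi hη a.hp)) fun a a' h =>
    Quotient.exact (mk_eq_of_isExp hη (Quotient.sound h)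
      (c := a.expo (isExponential_pi hη a.hp)) (c' := a'.expo (isExponential_pi hη a'.hp))
      _ _ (isExp_pi hη a.p) (isExp_pi hη a'.p) rfl rfl)

theorem normFun_mk {η : X ⟶ Y} (hη : IsOHom T.O η) {a : MObj M X} {c : MObj M Y} {X' : GSetIn T.C}
    {l : X' ⟶ a.A} {ρ : X' ⟶ c.A} (E : IsExp η a.p l ρ c.p) (hρ : IsOHom T.O ρ)
    (hm : M.tr ρ hρ (M.res l a.m) = c.m) : normFun η hη (mk a) = mk c :=
  mk_eq_of_isExp hη rfl (c := a.expo (isExponential_pi hη a.hp)) _ hρ (isExp_pi hη a.p) E rfl hm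

theorem exists_expo {η : X ⟶ Y} (hη : IsOHom T.O η) (a : MObj M X) :
    ∃ (c : MObj M Y) (X' : GSetIn T.C) (l : X' ⟶ a.A) (ρ : X' ⟶ c.A) (hρ : IsOHom T.O ρ),
      IsExp η a.p l ρ c.p ∧ M.tr ρ hρ (M.res l a.m) = c.m :=
  ⟨a.expo (isExponential_pi hη a.hp), _, _, _, _, isExp_pi hη a.p, rfl⟩

theorem normFun_one (η : X ⟶ Y) (hη : IsOHom T.O η) : normFun η hη (1 : SM M X) = 1 :=
  normFun_mk hη (a := oneObj X) (c := oneObj Y) (IsExp.one η) hη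
    ((congrArg _ (map_one _)).trans (map_one _))

theorem normFun_mul (η : X ⟶ Y) (hη : IsOHom T.O η) (s t : SM M X) :
    normFun η hη (s * t) = normFun η hη s * normFun η hη t := by
  induction s using SM.ind with | _ a
  induction t using SM.ind with | _ b
  obtain ⟨c, X₁, l₁, ρ₁, hρ₁, E₁, h₁⟩ := exists_expo hη a
  obtain ⟨d, X₂, l₂, ρ₂, hρ₂, E₂, h₂⟩ := exists_expo hη b
  rw [normFun_mk hη E₁ hρ₁ h₁, normFun_mk hη E₂ hρ₂ h₂]
  have sqZ := fiberProd.isPullback T.mulSys a.p b.p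
  have sqY := fiberProd.isPullback T.mulSys c.p d.p
  have sq₁ := fiberProd.isPullback T.mulSys (fiberProd.fst T.mulSys c.p d.p) ρ₁
  -- The pasted square presents the top object as $X\times_Y(Y_1\times_Y Y_2)$, which is symmetric
  -- in the two factors. Hence it also maps to $X_2$ by some `d'`, and cancelling `E₂.sq` shows that
  -- the square for the second factor is a pull-back too.
  have out := sq₁.flip.paste_horiz E₁.sq
  obtain ⟨d', hd1, hd2⟩ := E₂.sq.exists_lift
    (fiberProd.snd T.mulSys (fiberProd.fst T.mulSys c.p d.p) ρ₁ ≫ l₁ ≫ a.p)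
    (fiberProd.fst T.mulSys (fiberProd.fst T.mulSys c.p d.p) ρ₁ ≫ fiberProd.snd T.mulSys c.p d.p)
    (by rw [out.w, Category.assoc, sqY.w])
  rw [sqY.w, ← hd1] at out
  have sq₂ := (IsPullback.of_right out hd2 E₂.sq).flip
  obtain ⟨ζ, hζ1, hζ2⟩ := sqZ.exists_lift
    (fiberProd.snd T.mulSys (fiberProd.fst T.mulSys c.p d.p) ρ₁ ≫ l₁) (d' ≫ l₂)
    (by rw [Category.assoc, Category.assoc, hd1])
  have E := E₁.prod E₂ sqZ sqY sq₁ sq₂ hζ1 hζ2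
  refine normFun_mk hη (a := a.prod b) (c := c.prod d) E (E.isOHom hη) ?_
  refine (congrArg _ (M.res_mul_res hζ1 hζ2 a.m b.m)).trans ((map_mul _ _ _).trans ?_)
  refine congrArg₂ (· * ·) ?_ ?_
  · rw [← h₁, M.res_tr sq₁ hρ₁ (E.isOHom hη), M.res_comp_apply]; rfl
  · rw [← h₂, M.res_tr sq₂ hρ₂ (E.isOHom hη), M.res_comp_apply]; rfl

/-- The multiplicative transfer along `η`. -/
def normHom (η : X ⟶ Y) (hη : IsOHom T.O η) : SM M X →* SM M Y where
  toFun := normFun η hη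
  map_one' := normFun_one η hη
  map_mul' := normFun_mul η hη

theorem normFun_id (hX : IsOHom T.O (𝟙 X)) (s : SM M X) : normFun (𝟙 X) hX s = s := by
  induction s using SM.ind with | _ a
  have E := IsExp.id a.p
  exact normFun_mk hX E (E.isOHom hX) (by rw [M.tr_id_apply, M.res_id_apply])

theorem normFun_comp (f : X ⟶ Y) (g : Y ⟶ Z) (hf : IsOHom T.O f) (hg : IsOHom T.O g)
    (hfg : IsOHom T.O (f ≫ g)) (s : SM M X) :
    normFun (f ≫ g) hfg s = normFun g hg (normFun f hf s) := by
  induction s using SM.ind with | _ a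
  obtain ⟨b, X₁, l₁, ρ₁, hρ₁, E₁, h₁⟩ := exists_expo hf a
  obtain ⟨c, X₂, l₂, ρ₂, hρ₂, E₂, h₂⟩ := exists_expo hg b
  rw [normFun_mk hf E₁ hρ₁ h₁, normFun_mk hg E₂ hρ₂ h₂]
  have sq := fiberProd.isPullback T.mulSys ρ₁ l₂
  have E := E₁.comp E₂ sq
  have hv := hρ₁.of_isPullback T.mulSys sq.flip
  refine normFun_mk hfg E (E.isOHom hfg) ?_
  -- The Mackey condition on `sq` exchanges the inner transfer and restriction, which separates the
  -- norm along `f` from the norm along `g`.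
  rw [M.tr_comp_apply _ _ hv hρ₂, M.res_comp_apply, ← M.res_tr sq.flip hρ₁ hv, h₁, h₂]

theorem resFun_normFun {X' Y' : GSetIn T.C} {g' : X' ⟶ Y'} {f' : X' ⟶ X} {f : Y' ⟶ Y} {g : X ⟶ Y}
    (sq : IsPullback g' f' f g) (hg : IsOHom T.O g) (hg' : IsOHom T.O g')
    (s : SM M X) : resFun f (normFun g hg s) = normFun g' hg' (resFun f' s) := by
  induction s using SM.ind with | _ a
  obtain ⟨a', fZ, sqZ, hfZ⟩ := exists_pull f' a
  obtain ⟨c, X₁, l, ρ, hρ, E, hm⟩ := exists_expo hg a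
  obtain ⟨c', fY, sqY, hfY⟩ := exists_pull f c
  rw [resFun_mk sqZ hfZ, normFun_mk hg E hρ hm, resFun_mk sqY hfY]
  have sqX := fiberProd.isPullback T.mulSys fY ρ
  -- The evaluation map `ζ` of the base-changed diagram is built in two stages: `t` lands in $X'$,
  -- and `ζ` lifts it to the pull-back of $A$ along `f'`.
  obtain ⟨t, ht1, ht2⟩ := sq.exists_lift (fiberProd.fst T.mulSys fY ρ ≫ c'.p)
    (fiberProd.snd T.mulSys fY ρ ≫ l ≫ a.p)
    (by rw [Category.assoc, sqY.w, reassoc_of% sqX.w, ← E.sq.w]; simp only [Category.assoc])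
  obtain ⟨ζ, hζ1, hζ2⟩ := sqZ.exists_lift t (fiberProd.snd T.mulSys fY ρ ≫ l)
    (by rw [ht2, Category.assoc])
  have E' := E.baseChange sq sqZ sqY sqX hζ2 (by rw [reassoc_of% hζ1, ht1])
  refine (normFun_mk hg' E' (E'.isOHom hg') ?_).symm
  rw [← hfZ, M.res_res hζ2, M.res_comp_apply, ← M.res_tr sqX hρ, hm, hfY]

theorem trFun_normFun {X' Y' : GSetIn T.C} {η : X ⟶ Y} {ξ : Z ⟶ X} {ζ : X' ⟶ Z} {η' : X' ⟶ Y'}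
    {υ : Y' ⟶ Y} (h : IsExponential η ξ ζ η' υ) (s : SM M Z) :
    trFun υ h.isOHom_upsilon (normFun η' h.isOHom_eta' (resFun ζ s)) =
      normFun η h.isOHom_eta (trFun ξ h.isOHom_xi s) := by
  induction s using SM.ind with | _ b
  obtain ⟨b', z, sq, hz⟩ := exists_pull ζ b
  obtain ⟨c, X₂, l, ρ, hρ, E, hm⟩ := exists_expo h.isOHom_eta' b'
  rw [resFun_mk sq hz, normFun_mk _ E hρ hm]
  -- Pasting the exponential diagram for `b'` onto the given one yields an exponential diagram for
  -- the composite of `b.p` with `ξ`, so the same object `c` represents both sides.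
  refine (normFun_mk _ (a := b.post ξ h.isOHom_xi) (c := c.post υ h.isOHom_upsilon)
    (h.isExp.trans sq E) hρ ?_).symm
  refine (congrArg _ (M.res_comp_apply l z b.m)).trans ?_
  rw [hz]
  exact hm

/-! ### Additivity -/

section Additivity

variable {L : Type u} {X : L → GSetIn T.C} {i : ∀ l, X l ⟶ Y}

/-- The glued object is the disjoint union of the `(b l).A`, with the element of $M$ supplied by
additivity. The last clause is its uniqueness: an object over $Y$ is the disjoint union of its
pull-backs to the summands. -/
theorem exists_glue (hi : Function.Bijective (fun s : sigmaObj X => sigmaObj.desc i s))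
    (b : ∀ l, MObj M (X l)) : ∃ c : MObj M Y, (∀ l, resFun (i l) (mk c) = mk (b l)) ∧
      ∀ (a : MObj M Y) (f : ∀ l, (b l).A ⟶ a.A), (∀ l, IsPullback (b l).p (f l) (i l) a.p) →
        (∀ l, M.res (f l) a.m = (b l).m) → mk c = mk a := by
  have inj : ∀ {l l'} {x : X l} {x' : X l'}, i l x = i l' x' →
      (⟨l, x⟩ : sigmaObj X) = (⟨l', x'⟩ : sigmaObj X) := fun h => hi.1 h
  have hid : Function.Bijective (fun s : sigmaObj (fun l => (b l).A) =>
      sigmaObj.desc (sigmaObj.ι fun l => (b l).A) s) := Function.bijective_id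
  obtain ⟨m, hm⟩ := (M.sigma_bijective hid).2 fun l => (b l).m
  let p : sigmaObj (fun l => (b l).A) ⟶ Y := sigmaObj.desc fun l => (b l).p ≫ i l
  have hp : IsOHom (finO T.C) p := by
    -- A point $y$ lies in exactly one summand, so its fiber under `p` is a single fiber of one `(b
    -- l).p`; this gives finite fibers even for infinite index sets.
    refine isOHom_finO _ fun y => ?_
    obtain ⟨⟨l, x⟩, rfl⟩ := hi.2 y
    refine (((b l).hp.1 x).image (sigmaObj.ι (fun l => (b l).A) l)).subset ?_
    rintro ⟨l', z⟩ hz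
    have h := inj (x := (b l').p z) (x' := x) hz
    obtain rfl : l' = l := congrArg Sigma.fst h
    exact ⟨z, eq_of_heq (Sigma.ext_iff.1 h).2, rfl⟩
  refine ⟨⟨sigmaObj fun l => (b l).A, p, hp, m⟩, fun l => ?_, fun a f sq hf => ?_⟩
  · refine resFun_mk (k := sigmaObj.ι (fun l => (b l).A) l)
      (isPullback_of_forall T.mulSys ?_ ?_ ?_) (congrFun hm l)
    · exact fun x => rfl
    · exact fun x y _ h => eq_of_heq (Sigma.ext_iff.1 h).2
    · rintro x ⟨l', z⟩ hz
      have h := inj (x := (b l').p z) (x' := x) hz.symm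
      obtain rfl : l' = l := congrArg Sigma.fst h
      exact ⟨z, eq_of_heq (Sigma.ext_iff.1 h).2, rfl⟩
  · refine mk_eq (sigmaObj.desc f) ⟨?_, ?_⟩ (GSetIn.hom_ext fun s => ?_)
      ((M.sigma_bijective hid).1 ?_)
    · rintro ⟨l, x⟩ ⟨l', x'⟩ h
      have h' : f l x = f l' x' := h
      have h'' := inj (x := (b l).p x) (x' := (b l').p x')
        (by rw [pullback_w (sq l), pullback_w (sq l'), h'])
      obtain rfl : l = l' := congrArg Sigma.fst h''
      obtain rfl : x = x' := pullback_inj T.mulSys (sq l) (eq_of_heq (Sigma.ext_iff.1 h'').2) h'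
      rfl
    · intro y
      obtain ⟨⟨l, x⟩, h⟩ := hi.2 (a.p y)
      obtain ⟨z, -, hz⟩ := pullback_surj T.mulSys (sq l) (show i l x = a.p y from h)
      exact ⟨⟨l, z⟩, hz⟩
    · exact (pullback_w (sq s.1) s.2).symm
    · funext l
      exact (M.res_res rfl a.m).trans ((hf l).trans (congrFun hm l).symm)

theorem resFun_bijective (hi : Nonempty (IsColimit (Cofan.mk Y i))) :
    Function.Bijective (fun (s : SM M Y) (l : L) => resFun (i l) s) := by
  have hi' := sigmaObj.bijective_of_isColimit hi
  constructor
  · intro s t hst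
    induction s using SM.ind with | _ a
    induction t using SM.ind with | _ a'
    choose b f sq hf using fun l => exists_pull (i l) a
    choose b' f' sq' hf' using fun l => exists_pull (i l) a'
    obtain ⟨c, -, hc⟩ := exists_glue hi' b
    have hb : ∀ l, mk (b l) = mk (b' l) := fun l => by
      rw [← resFun_mk (sq l) (hf l), ← resFun_mk (sq' l) (hf' l)]
      exact congrFun hst l
    choose e h1 h2 using fun l => exists_iso (hb l)
    -- Through the isomorphisms `e l` the objects `b l` are pull-backs of `a'` as well as of `a`, so
    -- both classes equal that of the object glued from the `b l`.
    refine (hc a f sq hf).symm.trans (hc a' (fun l => (e l).hom ≫ f' l) (fun l => ?_) fun l => ?_)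
    · exact IsPullback.of_iso (sq' l) (e l).symm (Iso.refl _) (Iso.refl _) (Iso.refl _)
        (by simp [← h1]) (by simp) (by simp) (by simp)
    · rw [M.res_comp_apply, hf', h2]
  · intro s
    obtain ⟨c, hc, -⟩ := exists_glue hi' fun l => (s l).out
    refine ⟨mk c, funext fun l => (hc l).trans ?_⟩
    exact Quotient.out_eq (s l)

end Additivity

variable (M) in
/-- The semi-Tambara functor `S_M`. -/
def semiTambaraStructure : SemiTambaraStructure T (SM M) where
  res := resHom
  tr := trHom
  norm := normHom
  additive :=
    { res_id := fun _ => MonoidHom.ext resFun_id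
      res_comp := fun f g => MonoidHom.ext (resFun_comp f g)
      tr_id := fun _ hX => MonoidHom.ext (trFun_id hX)
      tr_comp := fun f g hf hg => MonoidHom.ext (trFun_comp f g hf hg _)
      mackey := fun sq hg => MonoidHom.ext (resFun_trFun sq hg _)
      additive := fun _ _ _ hi => resFun_bijective hi }
  multiplicative :=
    { res_id := fun _ => MonoidHom.ext resFun_id
      res_comp := fun f g => MonoidHom.ext (resFun_comp f g)
      tr_id := fun _ hX => MonoidHom.ext (normFun_id hX)
      tr_comp := fun f g hf hg => MonoidHom.ext (normFun_comp f g hf hg _)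
      mackey := fun sq hg => MonoidHom.ext (resFun_normFun sq hg _)
      -- Additivity is bijectivity of one map of sets, so the same proof serves the additive and the
      -- multiplicative monoids.
      additive := fun _ _ _ hi => resFun_bijective hi }
  exponential h s := trFun_normFun h s

end SM

end StructureMaps

end Tambarization

theorem mainTheorem3 {G : Type u} [Group G] (T : TambaraSystem G)
    (M : SemiMackeyFunctor.{u, w} T.mulSys) :
    ∃ (_ : ∀ X : GSetIn T.C, CommSemiring (SM M X)),
      (∀ (X : GSetIn T.C) (a b : MObj M X), SM.mk a + SM.mk b = SM.mk (a.sum b)) ∧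
      (∀ (X : GSetIn T.C) (a b : MObj M X), SM.mk a * SM.mk b = SM.mk (a.prod b)) ∧
      ∃ S : SemiTambaraStructure T (SM M),
        (∀ {X Y : GSetIn T.C} (ζ : Y ⟶ X) (a : MObj M X)
          {A' : GSetIn T.C} {p' : A' ⟶ Y} {ζ' : A' ⟶ a.A} (sq : IsPullback p' ζ' ζ a.p),
          S.res ζ (SM.mk a) = SM.mk (a.pull sq)) ∧
        (∀ {X Y : GSetIn T.C} (ξ : X ⟶ Y) (hξ : IsOHom (finO T.C) ξ) (a : MObj M X),
          S.tr ξ hξ (SM.mk a) = SM.mk (a.post ξ hξ)) ∧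
        (∀ {X Y : GSetIn T.C} (η : X ⟶ Y) (hη : IsOHom T.O η) (a : MObj M X)
          {X' Y' : GSetIn T.C} {l : X' ⟶ a.A} {ρ : X' ⟶ Y'} {υ : Y' ⟶ Y}
          (h : IsExponential η a.p l ρ υ),
          S.norm η hη (SM.mk a) = SM.mk (a.expo h)) := by
  refine ⟨fun _ => SM.commSemiring, fun _ a b => SM.mk_add a b, fun _ a b => SM.mk_mul a b,
    SM.semiTambaraStructure M, ?_, fun _ _ _ => rfl, ?_⟩
  · intro X Y ζ a A' p' ζ' sq
    exact SM.resFun_mk (c := a.pull sq) sq rfl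
  · intro X Y η hη a X' Y' l ρ υ h
    exact SM.normFun_mk hη (c := a.expo h) h.isExp h.isOHom_eta' rfl
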